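/- Let $G_2$ be the compact connected simple Lie group of type $G_2$, with Lie algebra $\mathfrak g$ and Killing form $\langle\cdot,\cdot\rangle$, and let $T\subset G_2$ be a maximal torus with Lie algebra $\mathfrak h$. Let $\alpha_1$ (long) and $\alpha_2$ (short) be simple roots, so that the positive roots are $\alpha_1,\ \alpha_2,\ \alpha_1+\alpha_2,\ \alpha_1+2\alpha_2,\ \alpha_1+3\alpha_2,\ 2\alpha_1+3\alpha_2$. For a root $\alpha$ with root space $\mathfrak g_\alpha\subset\mathfrak g^{\mathbb C}$ put $\mathfrak u_\alpha=\mathfrak g\cap(\mathfrak g_\alpha\oplus\mathfrak g_{-\alpha})$. Choose $w\in\mathfrak h$ with $\alpha_2(w)=0$ and $\alpha_1(w)\neq 0$, let $K\cong U(2)$ be the centralizer of $w$ in $G_2$, with Lie algebra $\mathfrak k=\{Y\in\mathfrak g:[Y,w]=0\}$, and let $G_2(\alpha_2)=G_2/K$ be the corresponding flag manifold (equivalently, the adjoint orbit of $w$), with origin $o=eK$. Let $\mathfrak m$ be the orthogonal complement of $\mathfrak k$ in $\mathfrak g$ with respect to $\langle\cdot,\cdot\rangle$, identified with $T_o(G_2/K)$,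 and put $$\mathfrak m_{\alpha_1}=\mathfrak u_{\alpha_1}+\mathfrak u_{\alpha_1+\alpha_2}+\mathfrak u_{\alpha_1+2\alpha_2}+\mathfrak u_{\alpha_1+3\alpha_2},\qquad \mathfrak m_{2\alpha_1}=\mathfrak u_{2\alpha_1+3\alpha_2}.$$ A vector $X\in\mathfrak m$ is called an equigeodesic vector if the curve $\gamma(t)=\exp(tX)\cdot o$ is a geodesic of every $G_2$-invariant Riemannian metric on $G_2/K$. Then $\mathfrak m=\mathfrak m_{\alpha_1}\oplus\mathfrak m_{2\alpha_1}$, and a nonzero vector $X\in\mathfrak m$ is an equigeodesic vector if and only if $X\in\mathfrak m_{\alpha_1}$ or $X\in\mathfrak m_{2\alpha_1}$. -/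

import Mathlib

open scoped ContDiff

attribute [local instance 100] LieRing.ofAssociativeRing

namespace G2Flag

open scoped Matrix Matrix.Norms.Operator

noncomputable section

/-- Real `7 × 7` matrices, acting on `ℝ⁷ = ℝ ⊕ ℂ³`: coordinate `0` spans the line, and
`(1,2)`, `(3,4)`, `(5,6)` are the real and imaginary parts of `z₁, z₂, z₃`. -/
abbrev Mat7 := Matrix (Fin 7) (Fin 7) ℝ

/-- The alternating form `eⁱ ∧ eʲ ∧ eᵏ` on `ℝ⁷`. -/
def wedge (i j k : Fin 7) (x y z : Fin 7 → ℝ) : ℝ :=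
  Matrix.det !![x i, x j, x k; y i, y j, y k; z i, z j, z k]

/-- The `3`-form `e⁰ ∧ ω + Re (dz₁ ∧ dz₂ ∧ dz₃)` on `ℝ⁷`, that is, the form
`⟨x, y · z⟩` of the imaginary octonions. -/
def phi (x y z : Fin 7 → ℝ) : ℝ :=
  wedge 0 1 2 x y z + wedge 0 3 4 x y z + wedge 0 5 6 x y z + wedge 1 3 5 x y z
    - wedge 1 4 6 x y z - wedge 2 3 6 x y z - wedge 2 4 5 x y z

/-- The compact group `G₂`: the stabilizer of `phi` in `GL(7, ℝ)`. -/
def G2 : Subgroup (GL (Fin 7) ℝ) where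
  carrier := {A | ∀ x y z, phi (A.1 *ᵥ x) (A.1 *ᵥ y) (A.1 *ᵥ z) = phi x y z}
  one_mem' := by intro x y z; simp
  mul_mem' := by
    intro A B hA hB x y z
    have h := hA (B.1 *ᵥ x) (B.1 *ᵥ y) (B.1 *ᵥ z)
    simp only [Matrix.mulVec_mulVec] at h
    have h' := hB x y z
    simp only [Units.val_mul]
    exact h.trans h'
  inv_mem' := by
    intro A hA x y z
    have h := hA (A⁻¹.1 *ᵥ x) (A⁻¹.1 *ᵥ y) (A⁻¹.1 *ᵥ z)
    have e : A.1 * A⁻¹.1 = 1 := A.mul_inv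
    simp only [Matrix.mulVec_mulVec, e, Matrix.one_mulVec] at h
    exact h.symm

theorem phi_add_left (x x' y z : Fin 7 → ℝ) : phi (x + x') y z = phi x y z + phi x' y z := by
  simp only [phi, wedge, Matrix.det_fin_three]; simp; ring

theorem phi_add_mid (x y y' z : Fin 7 → ℝ) : phi x (y + y') z = phi x y z + phi x y' z := by
  simp only [phi, wedge, Matrix.det_fin_three]; simp; ring

theorem phi_add_right (x y z z' : Fin 7 → ℝ) : phi x y (z + z') = phi x y z + phi x y z' := by
  simp only [phi, wedge, Matrix.det_fin_three]; simp; ring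

theorem phi_smul_left (c : ℝ) (x y z : Fin 7 → ℝ) : phi (c • x) y z = c * phi x y z := by
  simp only [phi, wedge, Matrix.det_fin_three]; simp; ring

theorem phi_smul_mid (c : ℝ) (x y z : Fin 7 → ℝ) : phi x (c • y) z = c * phi x y z := by
  simp only [phi, wedge, Matrix.det_fin_three]; simp; ring

theorem phi_smul_right (c : ℝ) (x y z : Fin 7 → ℝ) : phi x y (c • z) = c * phi x y z := by
  simp only [phi, wedge, Matrix.det_fin_three]; simp; ring

theorem phi_sub_left (x x' y z : Fin 7 → ℝ) : phi (x - x') y z = phi x y z - phi x' y z := by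
  simp only [phi, wedge, Matrix.det_fin_three]; simp; ring

theorem phi_sub_mid (x y y' z : Fin 7 → ℝ) : phi x (y - y') z = phi x y z - phi x y' z := by
  simp only [phi, wedge, Matrix.det_fin_three]; simp; ring

theorem phi_sub_right (x y z z' : Fin 7 → ℝ) : phi x y (z - z') = phi x y z - phi x y z' := by
  simp only [phi, wedge, Matrix.det_fin_three]; simp; ring

/-- The Lie algebra of `G2`: the matrices that annihilate `phi`. -/
def g2 : LieSubalgebra ℝ Mat7 where
  carrier := {X | ∀ x y z, phi (X *ᵥ x) y z + phi x (X *ᵥ y) z + phi x y (X *ᵥ z) = 0}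
  zero_mem' := by
    intro x y z
    have h := phi_smul_left 0 0 y z
    have h' := phi_smul_mid 0 x 0 z
    have h'' := phi_smul_right 0 x y 0
    simp only [zero_smul, zero_mul] at h h' h''
    simp [h, h', h'']
  add_mem' := by
    intro X Y hX hY x y z
    have h := hX x y z
    have h' := hY x y z
    simp only [Matrix.add_mulVec, phi_add_left, phi_add_mid, phi_add_right]
    linear_combination h + h'
  smul_mem' := by
    intro c X hX x y z
    have h := hX x y z
    simp only [Matrix.smul_mulVec, phi_smul_left, phi_smul_mid, phi_smul_right]
    linear_combination c * h
  lie_mem' := by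
    intro X Y hX hY x y z
    have h1 := hX (Y *ᵥ x) y z
    have h2 := hX x (Y *ᵥ y) z
    have h3 := hX x y (Y *ᵥ z)
    have k1 := hY (X *ᵥ x) y z
    have k2 := hY x (X *ᵥ y) z
    have k3 := hY x y (X *ᵥ z)
    simp only [Ring.lie_def, Matrix.sub_mulVec, phi_sub_left, phi_sub_mid, phi_sub_right,
      ← Matrix.mulVec_mulVec]
    linear_combination h1 + h2 + h3 - k1 - k2 - k3

/-- The matrix acting on `ℝ ⊕ ℂ³` as `0 ⊕ diag(i a₁, i a₂, i a₃)`. -/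
def diagElt (a : Fin 3 → ℝ) : Mat7 :=
  !![0, 0, 0, 0, 0, 0, 0;
     0, 0, -a 0, 0, 0, 0, 0;
     0, a 0, 0, 0, 0, 0, 0;
     0, 0, 0, 0, -a 1, 0, 0;
     0, 0, 0, a 1, 0, 0, 0;
     0, 0, 0, 0, 0, 0, -a 2;
     0, 0, 0, 0, 0, a 2, 0]

theorem diagElt_mem (a : Fin 3 → ℝ) (ha : a 0 + a 1 + a 2 = 0) : diagElt a ∈ g2 := by
  intro x y z
  have h : a 2 = -a 0 - a 1 := by linarith
  simp only [phi, wedge, Matrix.det_fin_three, diagElt, h]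
  simp [Matrix.mulVec, dotProduct, Fin.sum_univ_succ]
  ring

/-! The Lie algebra of the maximal torus consists of the `diagElt a` with `a₁ + a₂ + a₃ = 0`.
A root is written as the real functional `α` for which `i α` is the eigenvalue. -/

/-- The functional `εᵢ`, the `i`-th diagonal entry. -/
def eps (i : Fin 3) : Module.Dual ℝ (Fin 3 → ℝ) := LinearMap.proj i

/-- The long simple root `ε₁ - ε₂`. -/
def α₁ : Module.Dual ℝ (Fin 3 → ℝ) := eps 0 - eps 1

/-- The short simple root `ε₂`. -/
def α₂ : Module.Dual ℝ (Fin 3 → ℝ) := eps 1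

/-- Real matrices viewed as complex ones. -/
def complexify : Mat7 →ₐ[ℝ] Matrix (Fin 7) (Fin 7) ℂ := Complex.ofRealAm.mapMatrix

/-- The complexification of `g2`. -/
def g2C : Submodule ℂ (Matrix (Fin 7) (Fin 7) ℂ) :=
  Submodule.span ℂ (complexify '' (g2 : Set Mat7))

/-- The complex root space of `α`: the `Z` in the complexified Lie algebra with
`[H, Z] = i α(H) Z` for all `H` in the Lie algebra of the maximal torus. -/
def rootSpace (α : Module.Dual ℝ (Fin 3 → ℝ)) : Submodule ℂ (Matrix (Fin 7) (Fin 7) ℂ) :=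
  g2C ⊓ ⨅ (a : Fin 3 → ℝ) (_ : a 0 + a 1 + a 2 = 0),
    Module.End.eigenspace
      (LieAlgebra.ad ℂ (Matrix (Fin 7) (Fin 7) ℂ) (complexify (diagElt a)))
      (Complex.I * (α a : ℂ))

/-- The real root space `𝔲_α`, the real points of the sum of the root spaces of `α` and `-α`. -/
def u (α : Module.Dual ℝ (Fin 3 → ℝ)) : Submodule ℝ g2 :=
  ((rootSpace α ⊔ rootSpace (-α)).restrictScalars ℝ).comap
    (complexify.toLinearMap ∘ₗ g2.toSubmodule.subtype)

/-- `𝔪_{α₁}`, the sum of the real root spaces of the positive roots with `α₁`-coefficient `1`. -/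
def mα₁ : Submodule ℝ g2 := u α₁ ⊔ u (α₁ + α₂) ⊔ u (α₁ + 2 • α₂) ⊔ u (α₁ + 3 • α₂)

/-- `𝔪_{2α₁}`, the real root space of the positive root with `α₁`-coefficient `2`. -/
def m2α₁ : Submodule ℝ g2 := u (2 • α₁ + 3 • α₂)

/-- The element of the torus algebra with `α₁(w) = 1` and `α₂(w) = 0`. Up to sign, `α₂` is the only
root that vanishes on it, so that its centralizer `K` in `G2` is the copy of `U(2)` determined by
the short root `α₂`. -/
def w : g2 := ⟨diagElt ![1, 0, -1], diagElt_mem _ (by simp)⟩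

/-- The Lie algebra of `K`: the centralizer of `w` in `g2`. -/
def isotropyAlgebra : Submodule ℝ g2 := (LieAlgebra.ad ℝ g2 w).ker

/-- `𝔪`, the orthogonal complement of the isotropy algebra for the Killing form. -/
def m : Submodule ℝ g2 := (killingForm ℝ g2).orthogonal isotropyAlgebra

/-- The flag manifold `G₂/K`, as the adjoint orbit of `w`; its origin is `w`. -/
def flag : Set Mat7 := {p | ∃ A ∈ G2, p = A.1 * (w : Mat7) * A⁻¹.1}

/-- The tangent space of the orbit at `p`, that is `[g2, p]`. -/
def tangent (p : Mat7) : Submodule ℝ Mat7 := g2.toSubmodule.map (LieAlgebra.ad ℝ Mat7 p)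

/-- A smooth Riemannian metric on `flag` that is invariant under `G2`. As `flag` is a compact
submanifold of the matrix space, a smooth field of bilinear forms on its tangent spaces is the
restriction of a smooth field `form` on the matrix space; all conditions but smoothness
concern only the tangent spaces of `flag`. -/
structure InvariantMetric where
  form : Mat7 → LinearMap.BilinForm ℝ Mat7
  smooth : ∀ v₁ v₂, ContDiff ℝ ∞ (fun p => form p v₁ v₂)
  symm : ∀ p ∈ flag, ∀ v₁ ∈ tangent p, ∀ v₂ ∈ tangent p, form p v₁ v₂ = form p v₂ v₁
  pos : ∀ p ∈ flag, ∀ v ∈ tangent p, v ≠ 0 → 0 < form p v v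
  invariant : ∀ A ∈ G2, ∀ p ∈ flag, ∀ v₁ ∈ tangent p, ∀ v₂ ∈ tangent p,
    form (A.1 * p * A⁻¹.1) (A.1 * v₁ * A⁻¹.1) (A.1 * v₂ * A⁻¹.1) = form p v₁ v₂

/-- The energy of a curve over `[a, b]`. -/
def energy (g : InvariantMetric) (a b : ℝ) (γ : ℝ → Mat7) : ℝ :=
  (1 / 2) * ∫ t in a..b, g.form (γ t) (deriv γ t) (deriv γ t)

/-- A geodesic of the metric `g`: a smooth curve in `flag` that, on every interval `[a, b]`, is a
critical point of the energy under smooth variations in `flag` with fixed end points. -/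
def IsGeodesic (g : InvariantMetric) (γ : ℝ → Mat7) : Prop :=
  ContDiff ℝ ∞ γ ∧ (∀ t, γ t ∈ flag) ∧
    ∀ a b : ℝ, a < b → ∀ V : ℝ → ℝ → Mat7,
      ContDiff ℝ ∞ (Function.uncurry V) → (∀ s t, V s t ∈ flag) →
      (∀ t, V 0 t = γ t) → (∀ s, V s a = γ a) → (∀ s, V s b = γ b) →
      HasDerivAt (fun s => energy g a b (V s)) 0 0

/-- The curve `t ↦ exp(tX) · o` in `flag`. -/
def homogeneousCurve (X : g2) (t : ℝ) : Mat7 :=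
  NormedSpace.exp (t • (X : Mat7)) * (w : Mat7) * NormedSpace.exp (-(t • (X : Mat7)))

/-- An equigeodesic vector: an `X ∈ 𝔪` for which `exp(tX) · o` is a geodesic of every
invariant metric. -/
def IsEquigeodesicVector (X : g2) : Prop :=
  X ∈ m ∧ ∀ g : InvariantMetric, IsGeodesic g (homogeneousCurve X)

end

end G2Flag

/-! For an invariant metric `g`, pull its value at `w` back along `Y ↦ [Y, w]` to a form `h` on `g2`
whose kernel is the isotropy algebra `𝔨`. The first variation of energy shows that `exp(tX) · o` is
a geodesic exactly when `h(X, [X, Z]) = 0` for every `Z` in `g2`. So the theorem reduces to algebra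
in the 14-dimensional Lie algebra, with `B(X, Y) = -tr(XY)` as invariant inner product.

Sufficiency. Invariance under `𝔨` forces `h` to be a multiple of `B` on each of `𝔪_{α₁}` and
`𝔪_{2α₁}`, which are also `h`-orthogonal: the torus makes `h` diagonal and constant on each real
root plane, and the `α₂`-string through `α₁` ties together the four constants on `𝔪_{α₁}`. If `X`
lies in one summand, `h(X, [X, Z])` is a multiple of `B(X, [X, Z]) = 0`
(`IsIsotropyInvariant.apply_bracketCoords_eq_zero`, `isGeodesic_homogeneousCurve`).

Necessity. One metric suffices. For the metric induced by `B` on the orbit, `h` is `B` on `𝔪_{α₁}`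
and `4B` on `𝔪_{2α₁}`, since `(ad w)²` is `-1` and `-4` there. With `X = X₁ + X₂`, the condition
becomes `B([X₁, X₂], Z) = 0` for all `Z`, so `[X₁, X₂] = 0`; as `ad X₂` scales lengths on `𝔪_{α₁}`
by a constant that vanishes only for `X₂ = 0`, one component is zero
(`mem_of_isGeodesic_inducedMetric`).

The decomposition of `𝔪` comes from the same eigenvalues of `(ad w)²`: a root with `α₁`-coefficient
`n` takes the value `n` at `w`. -/

namespace G2Flag

open scoped Matrix Matrix.Norms.Operator

noncomputable section

/-! ### Coordinates on `g2` -/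

/-- The element of `g2` with coordinates `p`: the coordinates `0, 1` parametrize the torus algebra,
and `(2, 3)`, `(4, 5)`, …, `(12, 13)` the real root spaces of `α₂`, `α₁`, `α₁ + α₂`, `α₁ + 2 α₂`,
`α₁ + 3 α₂`, `2 α₁ + 3 α₂`. -/
def ofCoords (p : Fin 14 → ℝ) : Mat7 :=
  !![0, -2 * p 7, 2 * p 6, 2 * p 3, -2 * p 2, -2 * p 9, -2 * p 8;
     2 * p 7, 0, -p 0, -p 4 - p 8, p 5 - p 9, p 2 - p 12, p 13 - p 3;
     -2 * p 6, p 0, 0, -p 5 - p 9, p 8 - p 4, -p 3 - p 13, -p 2 - p 12;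
     -2 * p 3, p 4 + p 8, p 5 + p 9, 0, -p 1, p 6 - p 10, p 11 - p 7;
     2 * p 2, p 9 - p 5, p 4 - p 8, p 1, 0, -p 7 - p 11, -p 6 - p 10;
     2 * p 9, p 12 - p 2, p 3 + p 13, p 10 - p 6, p 7 + p 11, 0, p 0 + p 1;
     2 * p 8, p 3 - p 13, p 2 + p 12, p 7 - p 11, p 6 + p 10, -p 0 - p 1, 0]

/-- The coordinates of a matrix in `g2`. -/
def toCoords (X : Mat7) : Fin 14 → ℝ :=
  ![-X 1 2, -X 3 4, -X 0 4 / 2, X 0 3 / 2, -(X 1 3 + X 2 4) / 2, (X 1 4 - X 2 3) / 2,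
    X 0 2 / 2, -X 0 1 / 2, -X 0 6 / 2, -X 0 5 / 2, -(X 3 5 + X 4 6) / 2, (X 3 6 - X 4 5) / 2,
    -(X 1 5 + X 2 6) / 2, (X 1 6 - X 2 5) / 2]

theorem phi_eq (x y z : Fin 7 → ℝ) : phi x y z =
    x 0 * (y 1 * z 2 - y 2 * z 1 + y 3 * z 4 - y 4 * z 3 + y 5 * z 6 - y 6 * z 5) +
    x 1 * (y 2 * z 0 - y 0 * z 2 + y 3 * z 5 - y 5 * z 3 - y 4 * z 6 + y 6 * z 4) +
    x 2 * (y 0 * z 1 - y 1 * z 0 - y 3 * z 6 + y 6 * z 3 - y 4 * z 5 + y 5 * z 4) +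
    x 3 * (y 4 * z 0 - y 0 * z 4 + y 5 * z 1 - y 1 * z 5 - y 6 * z 2 + y 2 * z 6) +
    x 4 * (y 0 * z 3 - y 3 * z 0 - y 6 * z 1 + y 1 * z 6 - y 5 * z 2 + y 2 * z 5) +
    x 5 * (y 6 * z 0 - y 0 * z 6 + y 1 * z 3 - y 3 * z 1 - y 2 * z 4 + y 4 * z 2) +
    x 6 * (y 0 * z 5 - y 5 * z 0 - y 1 * z 4 + y 4 * z 1 - y 2 * z 3 + y 3 * z 2) := by
  simp only [phi, wedge, Matrix.det_fin_three]
  simp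
  ring

theorem ofCoords_mem (p : Fin 14 → ℝ) : ofCoords p ∈ g2 := by
  intro x y z
  simp only [phi_eq, ofCoords]
  simp [Matrix.mulVec, dotProduct, Fin.sum_univ_succ]
  ring

set_option maxHeartbeats 1000000 in
theorem ofCoords_toCoords {X : Mat7} (hX : X ∈ g2) : ofCoords (toCoords X) = X := by
  have e : ∀ i j k : Fin 7, phi (X.col i) (Pi.single j 1) (Pi.single k 1) +
      phi (Pi.single i 1) (X.col j) (Pi.single k 1) +
      phi (Pi.single i 1) (Pi.single j 1) (X.col k) = 0 := by
    intro i j k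
    have h := hX (Pi.single i 1) (Pi.single j 1) (Pi.single k 1)
    simpa only [Matrix.mulVec_single_one] using h
  -- As `phi` is alternating, the 35 triples `i < j < k` give all the equations; they cut the 49
  -- entries down to 14 parameters.
  have h012 := e 0 1 2
  have h013 := e 0 1 3
  have h014 := e 0 1 4
  have h015 := e 0 1 5
  have h016 := e 0 1 6
  have h023 := e 0 2 3
  have h024 := e 0 2 4
  have h025 := e 0 2 5
  have h026 := e 0 2 6
  have h034 := e 0 3 4
  have h035 := e 0 3 5
  have h036 := e 0 3 6
  have h045 := e 0 4 5
  have h046 := e 0 4 6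
  have h056 := e 0 5 6
  have h123 := e 1 2 3
  have h124 := e 1 2 4
  have h125 := e 1 2 5
  have h126 := e 1 2 6
  have h134 := e 1 3 4
  have h135 := e 1 3 5
  have h136 := e 1 3 6
  have h145 := e 1 4 5
  have h146 := e 1 4 6
  have h156 := e 1 5 6
  have h234 := e 2 3 4
  have h235 := e 2 3 5
  have h236 := e 2 3 6
  have h245 := e 2 4 5
  have h246 := e 2 4 6
  have h256 := e 2 5 6
  have h345 := e 3 4 5
  have h346 := e 3 4 6
  have h356 := e 3 5 6
  have h456 := e 4 5 6
  clear e hX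
  simp [phi_eq] at *
  ext i j
  fin_cases i <;> fin_cases j <;> simp [ofCoords, toCoords] <;> linarith

theorem exists_ofCoords {X : Mat7} (hX : X ∈ g2) : ∃ p, X = ofCoords p :=
  ⟨_, (ofCoords_toCoords hX).symm⟩

/-- The Lie bracket of `g2` in coordinates. -/
def bracketCoords (p q : Fin 14 → ℝ) : Fin 14 → ℝ :=
  ![- 2 * (p 2 * q 3 - p 3 * q 2) + 2 * (p 4 * q 5 - p 5 * q 4) + 4 * (p 6 * q 7 - p 7 * q 6) + 2
      * (p 8 * q 9 - p 9 * q 8) + 2 * (p 12 * q 13 - p 13 * q 12),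
    4 * (p 2 * q 3 - p 3 * q 2) - 2 * (p 4 * q 5 - p 5 * q 4) - 2 * (p 6 * q 7 - p 7 * q 6) + 2 *
      (p 8 * q 9 - p 9 * q 8) + 2 * (p 10 * q 11 - p 11 * q 10),
    - (p 1 * q 3 - p 3 * q 1) - (p 4 * q 6 - p 6 * q 4) - (p 5 * q 7 - p 7 * q 5) - 2 * (p 6 * q 8
      - p 8 * q 6) - 2 * (p 7 * q 9 - p 9 * q 7) + (p 8 * q 10 - p 10 * q 8) + (p 9 * q 11 - p 11
      * q 9),
    (p 1 * q 2 - p 2 * q 1) - (p 4 * q 7 - p 7 * q 4) + (p 5 * q 6 - p 6 * q 5) - 2 * (p 6 * q 9 -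
      p 9 * q 6) + 2 * (p 7 * q 8 - p 8 * q 7) + (p 8 * q 11 - p 11 * q 8) - (p 9 * q 10 - p 10 *
      q 9),
    - (p 0 * q 5 - p 5 * q 0) + (p 1 * q 5 - p 5 * q 1) + 3 * (p 2 * q 6 - p 6 * q 2) + 3 * (p 3 *
      q 7 - p 7 * q 3) - (p 10 * q 12 - p 12 * q 10) - (p 11 * q 13 - p 13 * q 11),
    (p 0 * q 4 - p 4 * q 0) - (p 1 * q 4 - p 4 * q 1) + 3 * (p 2 * q 7 - p 7 * q 2) - 3 * (p 3 * q
      6 - p 6 * q 3) - (p 10 * q 13 - p 13 * q 10) + (p 11 * q 12 - p 12 * q 11),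
    - (p 0 * q 7 - p 7 * q 0) - (p 2 * q 4 - p 4 * q 2) + 2 * (p 2 * q 8 - p 8 * q 2) + (p 3 * q 5
      - p 5 * q 3) + 2 * (p 3 * q 9 - p 9 * q 3) - (p 8 * q 12 - p 12 * q 8) - (p 9 * q 13 - p 13
      * q 9),
    (p 0 * q 6 - p 6 * q 0) - (p 2 * q 5 - p 5 * q 2) + 2 * (p 2 * q 9 - p 9 * q 2) - (p 3 * q 4 -
      p 4 * q 3) - 2 * (p 3 * q 8 - p 8 * q 3) - (p 8 * q 13 - p 13 * q 8) + (p 9 * q 12 - p 12 *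
      q 9),
    - (p 0 * q 9 - p 9 * q 0) - (p 1 * q 9 - p 9 * q 1) - 2 * (p 2 * q 6 - p 6 * q 2) - (p 2 * q
      10 - p 10 * q 2) + 2 * (p 3 * q 7 - p 7 * q 3) - (p 3 * q 11 - p 11 * q 3) + (p 6 * q 12 - p
      12 * q 6) + (p 7 * q 13 - p 13 * q 7),
    (p 0 * q 8 - p 8 * q 0) + (p 1 * q 8 - p 8 * q 1) - 2 * (p 2 * q 7 - p 7 * q 2) - (p 2 * q 11
      - p 11 * q 2) - 2 * (p 3 * q 6 - p 6 * q 3) + (p 3 * q 10 - p 10 * q 3) + (p 6 * q 13 - p 13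
      * q 6) - (p 7 * q 12 - p 12 * q 7),
    - (p 0 * q 11 - p 11 * q 0) - 2 * (p 1 * q 11 - p 11 * q 1) + 3 * (p 2 * q 8 - p 8 * q 2) - 3
      * (p 3 * q 9 - p 9 * q 3) + (p 4 * q 12 - p 12 * q 4) + (p 5 * q 13 - p 13 * q 5),
    (p 0 * q 10 - p 10 * q 0) + 2 * (p 1 * q 10 - p 10 * q 1) + 3 * (p 2 * q 9 - p 9 * q 2) + 3 *
      (p 3 * q 8 - p 8 * q 3) + (p 4 * q 13 - p 13 * q 4) - (p 5 * q 12 - p 12 * q 5),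
    - 2 * (p 0 * q 13 - p 13 * q 0) - (p 1 * q 13 - p 13 * q 1) - (p 4 * q 10 - p 10 * q 4) + (p 5
      * q 11 - p 11 * q 5) - 3 * (p 6 * q 8 - p 8 * q 6) + 3 * (p 7 * q 9 - p 9 * q 7),
    2 * (p 0 * q 12 - p 12 * q 0) + (p 1 * q 12 - p 12 * q 1) - (p 4 * q 11 - p 11 * q 4) - (p 5 *
      q 10 - p 10 * q 5) - 3 * (p 6 * q 9 - p 9 * q 6) - 3 * (p 7 * q 8 - p 8 * q 7)]

theorem lie_ofCoords (p q : Fin 14 → ℝ) :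
    ⁅ofCoords p, ofCoords q⁆ = ofCoords (bracketCoords p q) := by
  -- Closure of `g2` under the bracket reduces the comparison of 49 entries to that of 14
  -- coordinates.
  rw [← ofCoords_toCoords (g2.lie_mem (ofCoords_mem p) (ofCoords_mem q))]
  have entry : ∀ i j, ⁅ofCoords p, ofCoords q⁆ i j =
      ∑ k, (ofCoords p i k * ofCoords q k j - ofCoords q i k * ofCoords p k j) := fun i j => by
    rw [Ring.lie_def, Matrix.sub_apply, Matrix.mul_apply, Matrix.mul_apply,
      Finset.sum_sub_distrib]
  congr 1
  generalize ⁅ofCoords p, ofCoords q⁆ = M at entry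
  ext i
  fin_cases i <;> simp [toCoords, bracketCoords] <;>
    simp [entry, Fin.sum_univ_seven, ofCoords] <;> ring

theorem transpose_of_mem {X : Mat7} (hX : X ∈ g2) : Xᵀ = -X := by
  obtain ⟨p, rfl⟩ := exists_ofCoords hX
  ext i j
  fin_cases i <;> fin_cases j <;> simp [ofCoords] <;> ring

theorem diagElt_eq_ofCoords (a : Fin 3 → ℝ) (ha : a 0 + a 1 + a 2 = 0) :
    diagElt a = ofCoords ![a 0, a 1, 0, 0, 0, 0, 0, 0, 0, 0, 0, 0, 0, 0] := by
  have h : a 2 = -a 0 - a 1 := by linarith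
  ext i j
  fin_cases i <;> fin_cases j <;> simp [ofCoords, diagElt, h]
  ring

/-! ### The Killing form -/

/-- If a finite-dimensional real Lie algebra carries an invariant inner product `B`, an element that
is isotropic for the Killing form is central. -/
theorem ad_eq_zero_of_killingForm_self_eq_zero {L : Type*} [LieRing L] [LieAlgebra ℝ L]
    [FiniteDimensional ℝ L] (B : LinearMap.BilinForm ℝ L) (symm : ∀ x y, B x y = B y x)
    (pos : ∀ x, x ≠ 0 → 0 < B x x) (inv : ∀ x y z : L, B ⁅x, y⁆ z = -B y ⁅x, z⁆) {x : L}
    (h : killingForm ℝ L x x = 0) (y : L) : ⁅x, y⁆ = 0 := by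
  let core : InnerProductSpace.Core ℝ L :=
    { inner := fun x y => B x y
      conj_inner_symm := fun x y => symm y x
      re_inner_nonneg := fun x => by
        rcases eq_or_ne x 0 with rfl | hx
        · simp
        · exact (pos x hx).le
      add_left := fun x y z => by simp
      smul_left := fun x y r => by simp
      definite := fun x hx => by
        by_contra hne
        exact (pos x hne).ne' hx }
  let _ : NormedAddCommGroup L := core.toNormedAddCommGroup
  let _ : InnerProductSpace ℝ L := InnerProductSpace.ofCore core.toCore
  have hB : ∀ x y : L, inner ℝ x y = B x y := fun _ _ => rfl
  let b := stdOrthonormalBasis ℝ L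
  -- Invariance makes `ad x` skew for `B`, so `tr (ad x)²` is minus the sum of the squared norms of
  -- the `[x, bᵢ]`.
  have htr : killingForm ℝ L x x = -∑ i, ‖⁅x, b i⁆‖ ^ 2 := by
    rw [killingForm_apply_apply, LinearMap.trace_eq_sum_inner _ b, ← Finset.sum_neg_distrib]
    refine Finset.sum_congr rfl fun i _ => ?_
    rw [← real_inner_self_eq_norm_sq, hB, hB, inv]
    simp
  rw [h, eq_comm, neg_eq_zero, Finset.sum_eq_zero_iff_of_nonneg fun _ _ => by positivity] at htr
  have had : LieAlgebra.ad ℝ L x = 0 := by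
    refine b.toBasis.ext fun i => ?_
    have := htr i (Finset.mem_univ _)
    simpa using this
  simpa using LinearMap.congr_fun had y

/-- The invariant inner product `-tr (X Y)` on matrices. -/
def negTrace : LinearMap.BilinForm ℝ Mat7 :=
  LinearMap.mk₂ ℝ (fun X Y => -(X * Y).trace)
    (fun X X' Y => by simp [add_mul, add_comm]) (fun c X Y => by simp)
    (fun X Y Y' => by simp [mul_add, add_comm]) (fun c X Y => by simp)

theorem negTrace_apply (X Y : Mat7) : negTrace X Y = -(X * Y).trace := rfl

theorem negTrace_symm (X Y : Mat7) : negTrace X Y = negTrace Y X := by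
  rw [negTrace_apply, negTrace_apply, Matrix.trace_mul_comm]

theorem negTrace_pos {X : Mat7} (hX : X ∈ g2) (h : X ≠ 0) : 0 < negTrace X X := by
  have h1 : negTrace X X = (Xᵀ * X).trace := by
    rw [negTrace_apply, transpose_of_mem hX]; simp
  have h2 : 0 ≤ (Xᵀ * X).trace := by
    simp only [Matrix.trace, Matrix.diag, Matrix.mul_apply, Matrix.transpose_apply]
    exact Finset.sum_nonneg fun _ _ => Finset.sum_nonneg fun _ _ => mul_self_nonneg _
  rw [h1]
  refine lt_of_le_of_ne h2 fun h3 => h ?_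
  have h4 : (Xᴴ * X).trace = 0 := by
    rw [Matrix.conjTranspose_eq_transpose_of_trivial]; exact h3.symm
  exact Matrix.trace_conjTranspose_mul_self_eq_zero_iff.mp h4

theorem negTrace_lie (X Y Z : Mat7) : negTrace ⁅X, Y⁆ Z = -negTrace Y ⁅X, Z⁆ := by
  simp only [negTrace_apply, Ring.lie_def, sub_mul, mul_sub, Matrix.trace_sub]
  rw [← mul_assoc Y X Z, ← mul_assoc Y Z X, Matrix.trace_mul_comm (Y * Z) X, mul_assoc X Y Z]
  ring

theorem lie_eq_zero_of_killingForm_self_eq_zero {X : g2} (h : killingForm ℝ g2 X X = 0) (Y : g2) :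
    ⁅X, Y⁆ = 0 := by
  refine ad_eq_zero_of_killingForm_self_eq_zero
    (negTrace.compl₁₂ g2.toSubmodule.subtype g2.toSubmodule.subtype) ?_ ?_ ?_ h Y
  · exact fun X Y => negTrace_symm _ _
  · exact fun X hX => negTrace_pos X.2 fun h => hX (Subtype.ext h)
  · exact fun X Y Z => negTrace_lie _ _ _

/-! ### The decomposition of `𝔪` -/

theorem ofCoords_add (p q : Fin 14 → ℝ) : ofCoords (p + q) = ofCoords p + ofCoords q := by
  ext i j
  fin_cases i <;> fin_cases j <;> simp [ofCoords] <;> ring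

theorem ofCoords_smul (c : ℝ) (p : Fin 14 → ℝ) : ofCoords (c • p) = c • ofCoords p := by
  ext i j
  fin_cases i <;> fin_cases j <;> simp [ofCoords] <;> ring

theorem toCoords_ofCoords (p : Fin 14 → ℝ) : toCoords (ofCoords p) = p := by
  ext i
  fin_cases i <;> simp [ofCoords, toCoords] <;> ring

/-- `ofCoords` as a linear equivalence onto `g2`. -/
def coordEquiv : (Fin 14 → ℝ) ≃ₗ[ℝ] g2 where
  toFun p := ⟨ofCoords p, ofCoords_mem p⟩
  invFun X := toCoords X
  map_add' p q := Subtype.ext (ofCoords_add p q)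
  map_smul' c p := Subtype.ext (ofCoords_smul c p)
  left_inv p := toCoords_ofCoords p
  right_inv X := Subtype.ext (ofCoords_toCoords X.2)

theorem coe_coordEquiv (p : Fin 14 → ℝ) : (coordEquiv p : Mat7) = ofCoords p := rfl

theorem lie_coordEquiv (p q : Fin 14 → ℝ) :
    ⁅coordEquiv p, coordEquiv q⁆ = coordEquiv (bracketCoords p q) :=
  Subtype.ext (lie_ofCoords p q)

theorem lie_diagElt (a : Fin 3 → ℝ) (ha : a 0 + a 1 + a 2 = 0) (p : Fin 14 → ℝ) :
    ⁅diagElt a, ofCoords p⁆ = ofCoords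
      ![0, 0, -(a 1 * p 3), a 1 * p 2, -((a 0 - a 1) * p 5), (a 0 - a 1) * p 4,
        -(a 0 * p 7), a 0 * p 6, -((a 0 + a 1) * p 9), (a 0 + a 1) * p 8,
        -((a 0 + 2 * a 1) * p 11), (a 0 + 2 * a 1) * p 10,
        -((2 * a 0 + a 1) * p 13), (2 * a 0 + a 1) * p 12] := by
  rw [diagElt_eq_ofCoords a ha, lie_ofCoords]
  congr 1
  ext i
  fin_cases i <;> simp [bracketCoords] <;> ring

theorem lie_w (p : Fin 14 → ℝ) :
    ⁅w, coordEquiv p⁆ = coordEquiv ![0, 0, 0, 0, -p 5, p 4, -p 7, p 6, -p 9, p 8, -p 11, p 10,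
      -(2 * p 13), 2 * p 12] := by
  apply Subtype.ext
  change ⁅diagElt ![1, 0, -1], ofCoords p⁆ = ofCoords _
  rw [lie_diagElt _ (by simp)]
  simp

theorem mem_isotropyAlgebra_iff (p : Fin 14 → ℝ) :
    coordEquiv p ∈ isotropyAlgebra ↔ ∀ i : Fin 14, 4 ≤ i → p i = 0 := by
  rw [isotropyAlgebra, LinearMap.mem_ker, LieAlgebra.ad_apply, lie_w,
    LinearEquiv.map_eq_zero_iff, funext_iff]
  simp [Fin.forall_fin_succ]
  tauto

/-- The Killing form is invariant and `X` commutes with `w`, so `ad w` can be moved onto `X`. Hence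
the image of `ad w` is orthogonal to `𝔨`. -/
theorem killingForm_eq_zero_of_lie_w {X Y : g2} (hX : X ∈ isotropyAlgebra) :
    killingForm ℝ g2 X ⁅w, Y⁆ = 0 := by
  have h : ⁅w, X⁆ = 0 := hX
  rw [killingForm, ← LieModule.traceForm_apply_lie_apply, ← lie_skew, h]
  simp

theorem exists_lie_w (p : Fin 14 → ℝ) (hp : ∀ i : Fin 14, i < 4 → p i = 0) :
    ∃ Y : g2, coordEquiv p = ⁅w, Y⁆ := by
  refine ⟨coordEquiv ![0, 0, 0, 0, p 5, -p 4, p 7, -p 6, p 9, -p 8, p 11, -p 10,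
      p 13 / 2, -(p 12 / 2)], ?_⟩
  rw [lie_w]
  congr 1
  ext i
  fin_cases i <;> simp [hp] <;> ring

theorem mem_m_iff (p : Fin 14 → ℝ) :
    coordEquiv p ∈ m ↔ ∀ i : Fin 14, i < 4 → p i = 0 := by
  constructor
  · intro h
    let p₀ : Fin 14 → ℝ := fun i => if i < 4 then p i else 0
    have h₀ : coordEquiv p₀ ∈ isotropyAlgebra := by
      rw [mem_isotropyAlgebra_iff]
      intro i hi
      simp [p₀, hi]
    obtain ⟨Y, hY⟩ := exists_lie_w (p - p₀) fun i hi => by simp [p₀, hi]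
    have hp : coordEquiv p = coordEquiv p₀ + ⁅w, Y⁆ := by rw [← hY, ← map_add]; simp
    have h₁ : killingForm ℝ g2 (coordEquiv p₀) (coordEquiv p) = 0 := h _ h₀
    rw [hp, map_add, killingForm_eq_zero_of_lie_w h₀, add_zero] at h₁
    -- The `𝔨`-component `p₀` is isotropic, hence central. Its brackets with one vector of `𝔲_{α₁}`
    -- and one of `𝔲_{α₁+α₂}` already display its four coordinates.
    have h₂ := lie_eq_zero_of_killingForm_self_eq_zero h₁
    have h₃ := h₂ (coordEquiv (Pi.single 4 1))
    have h₄ := h₂ (coordEquiv (Pi.single 6 1))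
    rw [lie_coordEquiv, LinearEquiv.map_eq_zero_iff, funext_iff] at h₃ h₄
    have e₀ := h₄ 7
    have e₁ := h₃ 5
    have e₂ := h₃ 6
    have e₃ := h₃ 7
    simp [bracketCoords, p₀] at e₀ e₁ e₂ e₃
    intro i hi
    fin_cases i <;> first | (exfalso; revert hi; decide) | (simp; linarith)
  · intro hp X hX
    obtain ⟨Y, hY⟩ := exists_lie_w p hp
    rw [hY]
    exact killingForm_eq_zero_of_lie_w hX

/-! ### Real root spaces -/

theorem complexify_injective : Function.Injective complexify :=
  Matrix.map_injective Complex.ofReal_injective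

theorem complexify_lie (X Y : Mat7) : complexify ⁅X, Y⁆ = ⁅complexify X, complexify Y⁆ := by
  simp only [Ring.lie_def, map_sub, map_mul]

theorem mem_rootSpace_iff (α : Module.Dual ℝ (Fin 3 → ℝ)) (Z : Matrix (Fin 7) (Fin 7) ℂ) :
    Z ∈ rootSpace α ↔ Z ∈ g2C ∧ ∀ a : Fin 3 → ℝ, a 0 + a 1 + a 2 = 0 →
      ⁅complexify (diagElt a), Z⁆ = (Complex.I * (α a : ℂ)) • Z := by
  simp only [rootSpace, Submodule.mem_inf, Submodule.mem_iInf, Module.End.mem_eigenspace_iff,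
    LieAlgebra.ad_apply]

/-- The eigenvalues `iα(a)` and `-iα(a)` have the same square, so the two root components need not
be separated. -/
theorem lie_lie_of_mem_u {α : Module.Dual ℝ (Fin 3 → ℝ)} {X : g2} (hX : X ∈ u α)
    (a : Fin 3 → ℝ) (ha : a 0 + a 1 + a 2 = 0) :
    ⁅diagElt a, ⁅diagElt a, (X : Mat7)⁆⁆ = -(α a) ^ 2 • (X : Mat7) := by
  have hX' : complexify (X : Mat7) ∈ rootSpace α ⊔ rootSpace (-α) := hX
  obtain ⟨Z, hZ, Z', hZ', h⟩ := Submodule.mem_sup.mp hX'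
  have h₁ := ((mem_rootSpace_iff _ _).mp hZ).2 a ha
  have h₂ := ((mem_rootSpace_iff _ _).mp hZ').2 a ha
  apply complexify_injective
  rw [complexify_lie, complexify_lie, map_smul, ← h, lie_add, h₁, h₂, lie_add, lie_smul, lie_smul,
    h₁, h₂, smul_smul, smul_smul, smul_add]
  have e : ∀ c : ℝ, ∀ M : Matrix (Fin 7) (Fin 7) ℂ, c • M = (c : ℂ) • M := fun c M => by
    ext i j; simp
  rw [e, e]
  congr 2
  · push_cast; linear_combination (α a : ℂ) ^ 2 * Complex.I_mul_I
  · simp only [LinearMap.neg_apply]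
    push_cast; linear_combination (α a : ℂ) ^ 2 * Complex.I_mul_I

/-- The torus rotates the pair `X, Y`, so `X - iY` and `X + iY` are root vectors for `α` and `-α`,
and `X` is half their sum. -/
theorem mem_u_of_lie {α : Module.Dual ℝ (Fin 3 → ℝ)} {X Y : g2}
    (hX : ∀ a : Fin 3 → ℝ, a 0 + a 1 + a 2 = 0 → ⁅diagElt a, (X : Mat7)⁆ = α a • (Y : Mat7))
    (hY : ∀ a : Fin 3 → ℝ, a 0 + a 1 + a 2 = 0 → ⁅diagElt a, (Y : Mat7)⁆ = -α a • (X : Mat7)) :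
    X ∈ u α := by
  change complexify (X : Mat7) ∈ rootSpace α ⊔ rootSpace (-α)
  have e : ∀ c : ℝ, ∀ M : Matrix (Fin 7) (Fin 7) ℂ, c • M = (c : ℂ) • M := fun c M => by
    ext i j; simp
  have hmem : ∀ Z : g2, complexify (Z : Mat7) ∈ g2C := fun Z =>
    Submodule.subset_span ⟨Z, Z.2, rfl⟩
  have key : ∀ a : Fin 3 → ℝ, a 0 + a 1 + a 2 = 0 → ∀ c : ℂ,
      ⁅complexify (diagElt a), (1 / 2 : ℂ) • complexify (X : Mat7) + c • complexify (Y : Mat7)⁆ =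
        ((1 / 2 : ℂ) * α a) • complexify (Y : Mat7) - (c * α a) • complexify (X : Mat7) := by
    intro a ha c
    rw [lie_add, lie_smul, lie_smul, ← complexify_lie, ← complexify_lie, hX a ha, hY a ha,
      map_smul, map_smul, e, e, smul_smul, smul_smul, sub_eq_add_neg, ← neg_smul]
    push_cast
    rw [mul_neg]
  refine Submodule.mem_sup.mpr
    ⟨(1 / 2 : ℂ) • complexify (X : Mat7) + (-(Complex.I / 2)) • complexify (Y : Mat7), ?_,
      (1 / 2 : ℂ) • complexify (X : Mat7) + (Complex.I / 2) • complexify (Y : Mat7), ?_, ?_⟩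
  · refine (mem_rootSpace_iff _ _).mpr ⟨g2C.add_mem (g2C.smul_mem _ (hmem X))
      (g2C.smul_mem _ (hmem Y)), fun a ha => ?_⟩
    rw [key a ha, smul_add, smul_smul, smul_smul, sub_eq_neg_add, ← neg_smul]
    congr 2
    · ring
    · linear_combination (α a : ℂ) / 2 * Complex.I_mul_I
  · refine (mem_rootSpace_iff _ _).mpr ⟨g2C.add_mem (g2C.smul_mem _ (hmem X))
      (g2C.smul_mem _ (hmem Y)), fun a ha => ?_⟩
    rw [key a ha, smul_add, smul_smul, smul_smul, sub_eq_neg_add, ← neg_smul,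
      LinearMap.neg_apply]
    push_cast
    congr 2
    · ring
    · linear_combination (α a : ℂ) / 2 * Complex.I_mul_I
  · module

/-- The action of `diagElt a` in coordinates. -/
def torusCoords (a : Fin 3 → ℝ) (p : Fin 14 → ℝ) : Fin 14 → ℝ :=
  ![0, 0, -(a 1 * p 3), a 1 * p 2, -((a 0 - a 1) * p 5), (a 0 - a 1) * p 4,
    -(a 0 * p 7), a 0 * p 6, -((a 0 + a 1) * p 9), (a 0 + a 1) * p 8,
    -((a 0 + 2 * a 1) * p 11), (a 0 + 2 * a 1) * p 10,
    -((2 * a 0 + a 1) * p 13), (2 * a 0 + a 1) * p 12]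

theorem mem_u_of_torusCoords {α : Module.Dual ℝ (Fin 3 → ℝ)} {p q : Fin 14 → ℝ}
    {c : (Fin 3 → ℝ) → ℝ} (hc : ∀ a, α a = c a) (hp : ∀ a, torusCoords a p = c a • q)
    (hq : ∀ a, torusCoords a q = -(c a • p)) : coordEquiv p ∈ u α := by
  refine mem_u_of_lie (Y := coordEquiv q) (fun a ha => ?_) fun a ha => ?_
  · rw [coe_coordEquiv, coe_coordEquiv, ← ofCoords_smul, hc, ← hp]
    exact lie_diagElt a ha p
  · rw [coe_coordEquiv, coe_coordEquiv, ← ofCoords_smul, hc, neg_smul, ← hq]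
    exact lie_diagElt a ha q

theorem lie_w_lie_w_of_mem_u {α : Module.Dual ℝ (Fin 3 → ℝ)} {X : g2} (hX : X ∈ u α) :
    ⁅w, ⁅w, X⁆⁆ = -(α ![1, 0, -1]) ^ 2 • X :=
  Subtype.ext (lie_lie_of_mem_u hX ![1, 0, -1] (by simp))

/-- The eigenspace of `(ad w)²` for the eigenvalue `-c`. -/
def adSqEigenspace (c : ℝ) : Submodule ℝ g2 :=
  LinearMap.ker (LieAlgebra.ad ℝ g2 w * LieAlgebra.ad ℝ g2 w + c • 1)

theorem mem_adSqEigenspace {c : ℝ} {X : g2} : X ∈ adSqEigenspace c ↔ ⁅w, ⁅w, X⁆⁆ = -c • X := by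
  rw [adSqEigenspace, LinearMap.mem_ker]
  simp [← eq_neg_iff_add_eq_zero]

theorem u_le_adSqEigenspace {α : Module.Dual ℝ (Fin 3 → ℝ)} {c : ℝ}
    (h : (α ![1, 0, -1]) ^ 2 = c) : u α ≤ adSqEigenspace c := fun X hX => by
  rw [mem_adSqEigenspace, lie_w_lie_w_of_mem_u hX, h]

/-- Each of the four roots equals `1` at `w`, because `α₁(w) = 1` and `α₂(w) = 0`. -/
theorem mα₁_le : mα₁ ≤ adSqEigenspace 1 := by
  refine sup_le (sup_le (sup_le ?_ ?_) ?_) ?_ <;> apply u_le_adSqEigenspace <;>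
    simp [α₁, α₂, eps]

theorem m2α₁_le : m2α₁ ≤ adSqEigenspace 4 := by
  apply u_le_adSqEigenspace
  norm_num [α₁, α₂, eps]

theorem lie_w_lie_w (p : Fin 14 → ℝ) :
    ⁅w, ⁅w, coordEquiv p⁆⁆ = coordEquiv ![0, 0, 0, 0, -p 4, -p 5, -p 6, -p 7, -p 8, -p 9, -p 10,
      -p 11, -(4 * p 12), -(4 * p 13)] := by
  rw [lie_w, lie_w]
  refine congrArg coordEquiv ?_
  ext i
  fin_cases i <;> simp <;> ring

theorem mem_mα₁_iff (p : Fin 14 → ℝ) :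
    coordEquiv p ∈ mα₁ ↔ (∀ i : Fin 14, i < 4 → p i = 0) ∧ p 12 = 0 ∧ p 13 = 0 := by
  constructor
  · intro h
    have h₁ := mem_adSqEigenspace.mp (mα₁_le h)
    rw [lie_w_lie_w, ← map_smul, coordEquiv.injective.eq_iff, funext_iff] at h₁
    have h₂ := h₁ 12
    have h₃ := h₁ 13
    simp at h₂ h₃
    refine ⟨fun i hi => ?_, by linarith, by linarith⟩
    have h₄ := h₁ i
    fin_cases i <;> first | (exfalso; revert hi; decide) | simpa using h₄
  · rintro ⟨h, h₁, h₂⟩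
    have hp : p = ![0, 0, 0, 0, p 4, p 5, 0, 0, 0, 0, 0, 0, 0, 0] +
        ![0, 0, 0, 0, 0, 0, p 6, p 7, 0, 0, 0, 0, 0, 0] +
        ![0, 0, 0, 0, 0, 0, 0, 0, p 8, p 9, 0, 0, 0, 0] +
        ![0, 0, 0, 0, 0, 0, 0, 0, 0, 0, p 10, p 11, 0, 0] := by
      ext i
      fin_cases i <;> simp [h, h₁, h₂]
    rw [hp, map_add, map_add, map_add]
    refine Submodule.add_mem_sup (Submodule.add_mem_sup (Submodule.add_mem_sup ?_ ?_) ?_) ?_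
    · refine mem_u_of_torusCoords (q := ![0, 0, 0, 0, -p 5, p 4, 0, 0, 0, 0, 0, 0, 0, 0])
        (c := fun a => a 0 - a 1) (fun a => ?_) (fun a => ?_) fun a => ?_
      · simp [α₁, eps]
      all_goals simp [torusCoords]
    · refine mem_u_of_torusCoords (q := ![0, 0, 0, 0, 0, 0, -p 7, p 6, 0, 0, 0, 0, 0, 0])
        (c := fun a => a 0) (fun a => ?_) (fun a => ?_) fun a => ?_
      · simp [α₁, α₂, eps]
      all_goals simp [torusCoords]
    · refine mem_u_of_torusCoords (q := ![0, 0, 0, 0, 0, 0, 0, 0, -p 9, p 8, 0, 0, 0, 0])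
        (c := fun a => a 0 + a 1) (fun a => ?_) (fun a => ?_) fun a => ?_
      · simp [α₁, α₂, eps]; ring
      all_goals simp [torusCoords]
    · refine mem_u_of_torusCoords (q := ![0, 0, 0, 0, 0, 0, 0, 0, 0, 0, -p 11, p 10, 0, 0])
        (c := fun a => a 0 + 2 * a 1) (fun a => ?_) (fun a => ?_) fun a => ?_
      · simp [α₁, α₂, eps]; ring
      all_goals simp [torusCoords]

theorem mem_m2α₁_iff (p : Fin 14 → ℝ) :
    coordEquiv p ∈ m2α₁ ↔ ∀ i : Fin 14, i < 12 → p i = 0 := by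
  constructor
  · intro h
    have h₁ := mem_adSqEigenspace.mp (m2α₁_le h)
    rw [lie_w_lie_w, ← map_smul, coordEquiv.injective.eq_iff, funext_iff] at h₁
    intro i hi
    have h₄ := h₁ i
    fin_cases i <;> first | (exfalso; revert hi; decide) | (simp at h₄ ⊢; linarith)
  · intro h
    refine mem_u_of_torusCoords (q := ![0, 0, 0, 0, 0, 0, 0, 0, 0, 0, 0, 0, -p 13, p 12])
      (c := fun a => 2 * a 0 + a 1) (fun a => ?_) (fun a => ?_) fun a => ?_
    · simp [α₁, α₂, eps]; ring
    · simp [torusCoords, h]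
    · ext i
      fin_cases i <;> simp [torusCoords, h]

theorem mα₁_sup_m2α₁ : mα₁ ⊔ m2α₁ = m := by
  apply le_antisymm
  · refine sup_le (fun X hX => ?_) fun X hX => ?_ <;>
      obtain ⟨p, rfl⟩ := coordEquiv.surjective X
    · exact (mem_m_iff p).mpr ((mem_mα₁_iff p).mp hX).1
    · exact (mem_m_iff p).mpr fun i hi => (mem_m2α₁_iff p).mp hX i (hi.trans (by decide))
  · intro X hX
    obtain ⟨p, rfl⟩ := coordEquiv.surjective X
    rw [mem_m_iff] at hX
    have hp : p = (fun i => if i < 12 then p i else 0) + fun i => if i < 12 then 0 else p i := by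
      ext i
      by_cases hi : i < 12 <;> simp [hi]
    rw [hp, map_add]
    refine Submodule.add_mem_sup ((mem_mα₁_iff _).mpr ⟨fun i hi => ?_, ?_, ?_⟩)
      ((mem_m2α₁_iff _).mpr fun i hi => ?_)
    · simp [hX i hi]
    · rfl
    · rfl
    · simp [hi]

theorem disjoint_mα₁_m2α₁ : Disjoint mα₁ m2α₁ := by
  rw [Submodule.disjoint_def]
  intro X h₁ h₂
  have e := (mem_adSqEigenspace.mp (mα₁_le h₁)).symm.trans (mem_adSqEigenspace.mp (m2α₁_le h₂))
  have hX : (3 : ℝ) • X = (-1 : ℝ) • X - (-4 : ℝ) • X := by module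
  rw [e, sub_self] at hX
  simpa using hX

/-! ### The group and the orbit -/

theorem hasDerivAt_wedge (i j k : Fin 7) {x y z : ℝ → Fin 7 → ℝ} {x' y' z' : Fin 7 → ℝ} {t : ℝ}
    (hx : HasDerivAt x x' t) (hy : HasDerivAt y y' t) (hz : HasDerivAt z z' t) :
    HasDerivAt (fun t => wedge i j k (x t) (y t) (z t))
      (wedge i j k x' (y t) (z t) + wedge i j k (x t) y' (z t) + wedge i j k (x t) (y t) z') t := by
  rw [hasDerivAt_pi] at hx hy hz
  simp only [wedge, Matrix.det_fin_three]
  simp only [Matrix.of_apply, Matrix.cons_val]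
  have h := fun a b c => ((hx a).mul (hy b)).mul (hz c)
  have h₁ := (((((h i j k).sub (h i k j)).sub (h j i k)).add (h k i j)).add (h j k i)).sub (h k j i)
  refine (h₁.congr_deriv ?_).congr_of_eventuallyEq (.of_forall fun t => ?_)
  · simp only [Pi.mul_apply]
    ring
  · simp only [Pi.add_apply, Pi.sub_apply, Pi.mul_apply]
    ring

theorem hasDerivAt_phi {x y z : ℝ → Fin 7 → ℝ} {x' y' z' : Fin 7 → ℝ} {t : ℝ}
    (hx : HasDerivAt x x' t) (hy : HasDerivAt y y' t) (hz : HasDerivAt z z' t) :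
    HasDerivAt (fun t => phi (x t) (y t) (z t))
      (phi x' (y t) (z t) + phi (x t) y' (z t) + phi (x t) (y t) z') t := by
  have h := fun i j k => hasDerivAt_wedge i j k hx hy hz
  refine ((((((((h 0 1 2).add (h 0 3 4)).add (h 0 5 6)).add (h 1 3 5)).sub (h 1 4 6)).sub
    (h 2 3 6)).sub (h 2 4 5)).congr_deriv ?_)
  simp only [phi]
  ring

theorem exp_mul_exp_neg (X : Mat7) : NormedSpace.exp X * NormedSpace.exp (-X) = 1 := by
  rw [← Matrix.exp_add_of_commute _ _ (Commute.neg_right (Commute.refl X)), add_neg_cancel,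
    NormedSpace.exp_zero]

theorem exp_neg_mul_exp (X : Mat7) : NormedSpace.exp (-X) * NormedSpace.exp X = 1 := by
  simpa using exp_mul_exp_neg (-X)

/-- The matrix exponential, with values in `GL(7, ℝ)`. -/
def expGL (X : Mat7) : GL (Fin 7) ℝ :=
  ⟨NormedSpace.exp X, NormedSpace.exp (-X), exp_mul_exp_neg X, exp_neg_mul_exp X⟩

/-- Along `t ↦ exp(tX)` the transported `phi` has zero derivative, because `X` annihilates `phi` at
each transported triple; its values at `1` and `0` therefore agree. -/
theorem expGL_mem {X : Mat7} (hX : X ∈ g2) : expGL X ∈ G2 := by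
  intro x y z
  have hd : ∀ (v : Fin 7 → ℝ) (t : ℝ), HasDerivAt (fun t : ℝ => NormedSpace.exp (t • X) *ᵥ v)
      (X *ᵥ (NormedSpace.exp (t • X) *ᵥ v)) t := by
    intro v t
    have h := hasDerivAt_exp_smul_const' (𝕂 := ℝ) X t
    let L : Mat7 →ₗ[ℝ] (Fin 7 → ℝ) := (Matrix.mulVecBilin ℝ ℝ).flip v
    have h₂ := (LinearMap.toContinuousLinearMap L).hasFDerivAt.comp_hasDerivAt t h
    rw [Matrix.mulVec_mulVec]
    exact h₂
  have hc : ∀ t : ℝ, HasDerivAt (fun t : ℝ => phi (NormedSpace.exp (t • X) *ᵥ x)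
      (NormedSpace.exp (t • X) *ᵥ y) (NormedSpace.exp (t • X) *ᵥ z)) 0 t := fun t => by
    have h := hasDerivAt_phi (hd x t) (hd y t) (hd z t)
    rwa [hX] at h
  have h := is_const_of_deriv_eq_zero (fun t => (hc t).differentiableAt)
    (fun t => (hc t).deriv) 1 0
  simpa [expGL] using h

theorem conj_mem_g2 {A : GL (Fin 7) ℝ} (hA : A ∈ G2) {X : Mat7} (hX : X ∈ g2) :
    A.1 * X * A⁻¹.1 ∈ g2 := by
  intro x y z
  have e : ∀ v, A.1 *ᵥ (A⁻¹.1 *ᵥ v) = v := fun v => by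
    rw [Matrix.mulVec_mulVec, A.mul_inv, Matrix.one_mulVec]
  have h := hX (A⁻¹.1 *ᵥ x) (A⁻¹.1 *ᵥ y) (A⁻¹.1 *ᵥ z)
  rw [← hA (X *ᵥ _), ← hA _ (X *ᵥ _), ← hA _ _ (X *ᵥ _)] at h
  simpa only [e, ← Matrix.mulVec_mulVec, mul_assoc] using h

theorem conj_lie (A : GL (Fin 7) ℝ) (X Y : Mat7) :
    A.1 * ⁅X, Y⁆ * A⁻¹.1 = ⁅A.1 * X * A⁻¹.1, A.1 * Y * A⁻¹.1⁆ := by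
  have e : A⁻¹.1 * A.1 = 1 := A.inv_mul
  have h : ∀ X Y : Mat7, A.1 * X * A⁻¹.1 * (A.1 * Y * A⁻¹.1) = A.1 * (X * Y) * A⁻¹.1 := by
    intro X Y
    calc A.1 * X * A⁻¹.1 * (A.1 * Y * A⁻¹.1) = A.1 * X * (A⁻¹.1 * A.1) * Y * A⁻¹.1 := by
          simp only [mul_assoc]
      _ = _ := by rw [e]; simp only [mul_assoc, one_mul]
  simp only [Ring.lie_def, mul_sub, sub_mul, h]

/-- The eigenvalues of `w` on `ℂ⁷` are `0` and `±i`. The resulting equation `p³ = -p` holds on the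
whole orbit, and its linearization serves to detect tangent vectors. -/
theorem w_cube : (w : Mat7) * w * w = -(w : Mat7) := by
  change diagElt _ * diagElt _ * diagElt _ = -diagElt _
  ext i j
  fin_cases i <;> fin_cases j <;> simp [diagElt, Matrix.mul_apply, Fin.sum_univ_seven]

theorem mem_g2_of_mem_flag {p : Mat7} (hp : p ∈ flag) : p ∈ g2 := by
  obtain ⟨A, hA, rfl⟩ := hp
  exact conj_mem_g2 hA w.2

theorem cube_of_mem_flag {p : Mat7} (hp : p ∈ flag) : p * p * p = -p := by
  obtain ⟨A, hA, rfl⟩ := hp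
  have e : A⁻¹.1 * A.1 = 1 := A.inv_mul
  calc _ = A.1 * w * (A⁻¹.1 * A.1) * w * (A⁻¹.1 * A.1) * w * A⁻¹.1 := by simp only [mul_assoc]
    _ = A.1 * ((w : Mat7) * w * w) * A⁻¹.1 := by rw [e]; simp only [mul_assoc, one_mul]
    _ = _ := by rw [w_cube]; simp

theorem conj_mem_flag {A : GL (Fin 7) ℝ} (hA : A ∈ G2) {p : Mat7} (hp : p ∈ flag) :
    A.1 * p * A⁻¹.1 ∈ flag := by
  obtain ⟨B, hB, rfl⟩ := hp
  refine ⟨A * B, G2.mul_mem hA hB, ?_⟩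
  simp [mul_assoc]

theorem w_mem_flag : (w : Mat7) ∈ flag := ⟨1, G2.one_mem, by simp⟩

theorem mem_tangent_iff {p v : Mat7} : v ∈ tangent p ↔ ∃ Y ∈ g2, ⁅Y, p⁆ = v := by
  constructor
  · rintro ⟨Y, hY, rfl⟩
    exact ⟨-Y, g2.neg_mem hY, by simp⟩
  · rintro ⟨Y, hY, rfl⟩
    exact ⟨-Y, g2.neg_mem hY, by simp⟩

/-- The inverse of `Y ↦ [Y, p]` on the tangent space of the orbit at `p`. -/
def lieInv (p v : Mat7) : Mat7 := (1 / 4 : ℝ) • (⁅p, ⁅p, ⁅p, v⁆⁆⁆ + (5 : ℝ) • ⁅p, v⁆)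

theorem lieInv_mem {p v : Mat7} (hp : p ∈ g2) (hv : v ∈ g2) : lieInv p v ∈ g2 :=
  g2.smul_mem _ (g2.add_mem (g2.lie_mem hp (g2.lie_mem hp (g2.lie_mem hp hv)))
    (g2.smul_mem _ (g2.lie_mem hp hv)))

/-- The linearized cubic equation `hv` confines `v` to the eigenvalues `±i, ±2i` of `D = ad p`, so
`D⁴ + 5D² + 4` kills `v`. Hence `(D³ + 5D)/4` inverts `-D`, which is `Y ↦ [Y, p]`. -/
theorem lie_lieInv {p v : Mat7} (hp : p * p * p = -p)
    (hv : v * p * p + p * v * p + p * p * v + v = 0) : ⁅lieInv p v, p⁆ = v := by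
  have h₁ : p * v * p * p + p * p * v * p = 0 := by
    have h := congrArg (p * ·) hv
    simp only [mul_add, mul_zero, ← mul_assoc, hp, neg_mul] at h
    rw [← h]; abel
  have h₂ : p * p * v * p * p = p * v * p := by
    have h := congrArg (p * ·) h₁
    simp only [mul_add, mul_zero, ← mul_assoc, hp, neg_mul] at h
    rw [← sub_eq_zero, ← h]; abel
  have hD : ∀ u : Mat7, ⁅p, ⁅p, u⁆⁆ = p * p * u - (2 : ℝ) • (p * u * p) + u * p * p := by
    intro u
    simp only [Ring.lie_def, mul_sub, sub_mul, ← mul_assoc]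
    module
  have h₃ : ⁅p, ⁅p, v⁆⁆ = -v - (3 : ℝ) • (p * v * p) := by
    rw [hD, eq_sub_iff_add_eq, eq_neg_iff_add_eq_zero, ← hv]
    module
  have h₄ : ⁅p, ⁅p, p * v * p⁆⁆ = -((4 : ℝ) • (p * v * p)) := by
    have e₁ : p * p * (p * v * p) = -(p * v * p) := by
      simp only [← mul_assoc, hp, neg_mul]
    have e₂ : p * v * p * p * p = -(p * v * p) := by
      rw [mul_assoc (p * v), mul_assoc (p * v), hp, mul_neg]
    have e₃ : p * (p * v * p) * p = p * v * p := by
      simpa only [mul_assoc] using h₂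
    rw [hD, e₁, e₂, e₃]
    module
  have h₅ : ⁅p, ⁅p, ⁅p, ⁅p, v⁆⁆⁆⁆ = v + (15 : ℝ) • (p * v * p) := by
    rw [h₃, lie_sub, lie_sub, lie_neg, lie_neg, lie_smul, lie_smul, h₃, h₄]
    module
  rw [← lie_skew, lieInv, lie_smul, lie_add, lie_smul, h₅, h₃]
  module

theorem cube_variation_of_lie {p Y : Mat7} (hp : p * p * p = -p) :
    ⁅Y, p⁆ * p * p + p * ⁅Y, p⁆ * p + p * p * ⁅Y, p⁆ + ⁅Y, p⁆ = 0 := by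
  have e : Y * p * p * p = -(Y * p) := by
    rw [mul_assoc Y, mul_assoc Y, hp, mul_neg]
  simp only [Ring.lie_def, mul_sub, sub_mul, ← mul_assoc, e, hp, neg_mul]
  abel

theorem tangent_le_g2 {p v : Mat7} (hp : p ∈ flag) (hv : v ∈ tangent p) : v ∈ g2 := by
  obtain ⟨Y, hY, rfl⟩ := mem_tangent_iff.mp hv
  exact g2.lie_mem hY (mem_g2_of_mem_flag hp)

theorem lie_lieInv_of_mem_tangent {p v : Mat7} (hp : p ∈ flag) (hv : v ∈ tangent p) :
    ⁅lieInv p v, p⁆ = v := by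
  obtain ⟨Y, hY, rfl⟩ := mem_tangent_iff.mp hv
  exact lie_lieInv (cube_of_mem_flag hp) (cube_variation_of_lie (cube_of_mem_flag hp))

theorem mem_g2_of_hasDerivAt {c : ℝ → Mat7} {v : Mat7} {s : ℝ} (hc : HasDerivAt c v s)
    (hmem : ∀ s, c s ∈ g2) : v ∈ g2 := by
  have hcl : IsClosed (g2.toSubmodule : Set Mat7) := Submodule.closed_of_finiteDimensional _
  refine hcl.mem_of_tendsto (hasDerivAt_iff_tendsto_slope.mp hc) (.of_forall fun t => ?_)
  exact g2.smul_mem _ (g2.sub_mem (hmem t) (hmem s))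

/-- The velocity of a curve in the orbit is tangent to the orbit. -/
theorem mem_tangent_of_hasDerivAt {c : ℝ → Mat7} {v : Mat7} {s : ℝ} (hc : HasDerivAt c v s)
    (hmem : ∀ s, c s ∈ flag) : v ∈ tangent (c s) := by
  have hv := mem_g2_of_hasDerivAt hc fun s => mem_g2_of_mem_flag (hmem s)
  -- Differentiating `c³ + c = 0` gives the linear condition under which `lieInv` recovers a `Y` in
  -- `g2` with `[Y, c s] = v`; no charts on the orbit are needed.
  have h₀ : (fun s => c s * c s * c s + c s) = fun _ => 0 := by
    ext1 s
    rw [cube_of_mem_flag (hmem s), neg_add_cancel]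
  have h₁ := ((hc.mul hc).mul hc).add hc
  have h₂ : HasDerivAt (fun s => c s * c s * c s + c s) (0 : Mat7) s := by
    rw [h₀]; exact hasDerivAt_const s 0
  have h₃ := h₁.unique h₂
  refine mem_tangent_iff.mpr ⟨lieInv (c s) v, lieInv_mem (mem_g2_of_mem_flag (hmem s)) hv,
    lie_lieInv (cube_of_mem_flag (hmem s)) ?_⟩
  rw [← h₃]
  simp only [Pi.mul_apply, add_mul]

/-! ### Parametric derivatives -/

section Parametric

variable {E : Type*} [NormedAddCommGroup E] [NormedSpace ℝ E]

theorem hasDerivAt_fst_of_contDiff {V : ℝ → ℝ → E} (hV : ContDiff ℝ 1 (Function.uncurry V))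
    (s t : ℝ) :
    HasDerivAt (fun s => V s t) (fderiv ℝ (Function.uncurry V) (s, t) (1, 0)) s :=
  HasFDerivAt.comp_hasDerivAt (f := fun s => (s, t)) s
    (hV.differentiable one_ne_zero (s, t)).hasFDerivAt
    ((hasDerivAt_id s).prodMk (hasDerivAt_const s t))

theorem hasDerivAt_snd_of_contDiff {V : ℝ → ℝ → E} (hV : ContDiff ℝ 1 (Function.uncurry V))
    (s t : ℝ) :
    HasDerivAt (V s) (fderiv ℝ (Function.uncurry V) (s, t) (0, 1)) t :=
  HasFDerivAt.comp_hasDerivAt (f := fun t => (s, t)) t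
    (hV.differentiable one_ne_zero (s, t)).hasFDerivAt
    ((hasDerivAt_const t s).prodMk (hasDerivAt_id t))

theorem contDiff_fderiv_apply_const {F : Type*} [NormedAddCommGroup F] [NormedSpace ℝ F]
    {f : F → E} (hf : ContDiff ℝ ∞ f) (v : F) : ContDiff ℝ ∞ fun x => fderiv ℝ f x v :=
  (hf.fderiv_right (m := ∞) le_rfl).clm_apply contDiff_const

/-- The mixed partial derivatives of a smooth function agree. -/
theorem hasDerivAt_deriv_comm {V : ℝ → ℝ → E} (hV : ContDiff ℝ ∞ (Function.uncurry V)) (s t : ℝ) :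
    HasDerivAt (fun s => deriv (V s) t) (deriv (fun t => deriv (fun s => V s t) s) t) s := by
  have h1 : ContDiff ℝ 1 (Function.uncurry V) := hV.of_le (by simp)
  have hd : ∀ v : ℝ × ℝ, ∀ q, HasFDerivAt (fun x => fderiv ℝ (Function.uncurry V) x v)
      ((fderiv ℝ (fderiv ℝ (Function.uncurry V)) q).flip v) q := by
    intro v q
    have h2 := (hV.fderiv_right (m := ∞) le_rfl).differentiable (by simp) q
    simpa using h2.hasFDerivAt.clm_apply (hasFDerivAt_const v q)
  have e₁ : (fun t => deriv (fun s => V s t) s) =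
      fun t => fderiv ℝ (Function.uncurry V) (s, t) (1, 0) :=
    funext fun t => (hasDerivAt_fst_of_contDiff h1 s t).deriv
  have e₂ : (fun s => deriv (V s) t) = fun s => fderiv ℝ (Function.uncurry V) (s, t) (0, 1) :=
    funext fun s => (hasDerivAt_snd_of_contDiff h1 s t).deriv
  rw [e₁, e₂]
  have h₁ := (hd (1, 0) (s, t)).comp_hasDerivAt t
    ((hasDerivAt_const t s).prodMk (hasDerivAt_id t))
  have h₂ := (hd (0, 1) (s, t)).comp_hasDerivAt s
    ((hasDerivAt_id s).prodMk (hasDerivAt_const s t))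
  have hsymm : IsSymmSndFDerivAt ℝ (Function.uncurry V) (s, t) :=
    hV.contDiffAt.isSymmSndFDerivAt (by simp [ENat.LEInfty.out])
  have e₃ : deriv (fun t => fderiv ℝ (Function.uncurry V) (s, t) (1, 0)) t = _ := h₁.deriv
  rw [e₃]
  refine h₂.congr_deriv ?_
  exact hsymm.eq _ _

/-- Differentiation under the integral sign for a `C¹` integrand. -/
theorem hasDerivAt_intervalIntegral_of_contDiff [CompleteSpace E] {F : ℝ → ℝ → E}
    (hF : ContDiff ℝ 1 (Function.uncurry F)) (a b s₀ : ℝ) :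
    HasDerivAt (fun s => ∫ t in a..b, F s t) (∫ t in a..b, deriv (fun s => F s t) s₀) s₀ := by
  let F' : ℝ → ℝ → E := fun s t => fderiv ℝ (Function.uncurry F) (s, t) (1, 0)
  have hF' : Continuous (Function.uncurry F') :=
    (hF.continuous_fderiv one_ne_zero).clm_apply continuous_const
  have hFc : ∀ s, Continuous (F s) := fun s =>
    hF.continuous.comp (Continuous.prodMk_right s)
  -- Compactness of a closed ball around `s₀` times the interval provides a constant dominating
  -- function.
  have hcpt := (isCompact_closedBall s₀ 1).prod (isCompact_uIcc (a := a) (b := b))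
  obtain ⟨C, hC⟩ := hcpt.exists_bound_of_continuousOn hF'.continuousOn
  have h := intervalIntegral.hasDerivAt_integral_of_dominated_loc_of_deriv_le
    (F := F) (F' := F') (μ := MeasureTheory.volume) (a := a) (b := b) (bound := fun _ => C)
    (Metric.closedBall_mem_nhds s₀ one_pos)
    (.of_forall fun s => (hFc s).aestronglyMeasurable) ((hFc s₀).intervalIntegrable a b)
    (Continuous.aestronglyMeasurable (hF'.comp (Continuous.prodMk_right s₀)))
    (.of_forall fun t ht s hs => hC (s, t) ⟨hs, Set.uIoc_subset_uIcc ht⟩)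
    intervalIntegrable_const
    (.of_forall fun t _ s _ => hasDerivAt_fst_of_contDiff hF s t)
  refine h.2.congr_deriv ?_
  exact intervalIntegral.integral_congr fun t _ => (hasDerivAt_fst_of_contDiff hF s₀ t).deriv.symm

end Parametric

/-! ### The first variation of the energy -/

/-- Conjugation by `exp Y`. -/
def conjExp (Y M : Mat7) : Mat7 := NormedSpace.exp Y * M * NormedSpace.exp (-Y)

theorem conjExp_zero (M : Mat7) : conjExp 0 M = M := by simp [conjExp]

theorem conjExp_lie (Y M N : Mat7) : conjExp Y ⁅M, N⁆ = ⁅conjExp Y M, conjExp Y N⁆ :=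
  conj_lie (expGL Y) M N

theorem conjExp_add (Y M N : Mat7) : conjExp Y (M + N) = conjExp Y M + conjExp Y N := by
  simp only [conjExp, mul_add, add_mul]

theorem conjExp_conjExp_neg (Y M : Mat7) : conjExp Y (conjExp (-Y) M) = M := by
  have e : ∀ A B : Mat7, A * B = 1 → A * (B * M * A) * B = M := fun A B h => by
    rw [← mul_assoc, ← mul_assoc, h, one_mul, mul_assoc, h, mul_one]
  simpa only [conjExp, neg_neg] using e _ _ (exp_mul_exp_neg Y)

theorem conjExp_neg_conjExp (Y M : Mat7) : conjExp (-Y) (conjExp Y M) = M := by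
  simpa using conjExp_conjExp_neg (-Y) M

theorem conjExp_mem_g2 {Y M : Mat7} (hY : Y ∈ g2) (hM : M ∈ g2) : conjExp Y M ∈ g2 :=
  conj_mem_g2 (expGL_mem hY) hM

theorem conjExp_mem_flag {Y p : Mat7} (hY : Y ∈ g2) (hp : p ∈ flag) : conjExp Y p ∈ flag :=
  conj_mem_flag (expGL_mem hY) hp

theorem form_conjExp (g : InvariantMetric) {Y p v₁ v₂ : Mat7} (hY : Y ∈ g2) (hp : p ∈ flag)
    (h₁ : v₁ ∈ tangent p) (h₂ : v₂ ∈ tangent p) :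
    g.form (conjExp Y p) (conjExp Y v₁) (conjExp Y v₂) = g.form p v₁ v₂ :=
  g.invariant _ (expGL_mem hY) p hp v₁ h₁ v₂ h₂

theorem hasDerivAt_conjExp (Y : Mat7) {M : ℝ → Mat7} {M' : Mat7} {t : ℝ}
    (hM : HasDerivAt M M' t) :
    HasDerivAt (fun t => conjExp (t • Y) (M t)) (conjExp (t • Y) (M' + ⁅Y, M t⁆)) t := by
  have h₁ : HasDerivAt (fun t : ℝ => NormedSpace.exp (t • Y)) (NormedSpace.exp (t • Y) * Y) t :=
    hasDerivAt_exp_smul_const (𝕂 := ℝ) Y t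
  have h₂ : HasDerivAt (fun t : ℝ => NormedSpace.exp (-(t • Y)))
      (-Y * NormedSpace.exp (-(t • Y))) t := by
    have h := hasDerivAt_exp_smul_const' (𝕂 := ℝ) (-Y) t
    simp only [smul_neg] at h
    exact h
  refine ((h₁.mul hM).mul h₂).congr_deriv ?_
  simp only [Pi.mul_apply, conjExp, Ring.lie_def, add_mul, mul_add, sub_mul, mul_sub, neg_mul,
    mul_neg, mul_assoc]
  abel

theorem contDiff_exp : ContDiff ℝ ∞ (NormedSpace.exp : Mat7 → Mat7) :=
  contDiff_iff_contDiffAt.mpr fun x => (NormedSpace.exp_analytic (𝕂 := ℝ) x).contDiffAt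

theorem contDiff_conjExp {F : Type*} [NormedAddCommGroup F] [NormedSpace ℝ F] {Y M : F → Mat7}
    (hY : ContDiff ℝ ∞ Y) (hM : ContDiff ℝ ∞ M) : ContDiff ℝ ∞ fun x => conjExp (Y x) (M x) :=
  ((contDiff_exp.comp hY).mul hM).mul (contDiff_exp.comp hY.neg)

/-- Smoothness is given only for fixed vectors; expanding both arguments in a basis makes it joint.
-/
theorem contDiff_form (g : InvariantMetric) :
    ContDiff ℝ ∞ fun q : Mat7 × Mat7 × Mat7 => g.form q.1 q.2.1 q.2.2 := by
  let b := Matrix.stdBasis ℝ (Fin 7) (Fin 7)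
  have hb : ∀ i, ContDiff ℝ ∞ (b.coord i) := fun i =>
    (LinearMap.toContinuousLinearMap (b.coord i)).contDiff
  have e : (fun q : Mat7 × Mat7 × Mat7 => g.form q.1 q.2.1 q.2.2) = fun q =>
      ∑ i, ∑ j, b.coord i q.2.1 * (b.coord j q.2.2 * g.form q.1 (b i) (b j)) := by
    ext1 q
    conv_lhs => rw [← b.sum_repr q.2.1, ← b.sum_repr q.2.2]
    simp only [map_sum, LinearMap.sum_apply, map_smul, LinearMap.smul_apply, smul_eq_mul,
      Module.Basis.coord_apply]
    rw [Finset.sum_comm]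
    refine Finset.sum_congr rfl fun j _ => ?_
    rw [Finset.mul_sum]
    exact Finset.sum_congr rfl fun i _ => by ring
  rw [e]
  refine ContDiff.sum fun i _ => ContDiff.sum fun j _ => ?_
  exact ((hb i).comp contDiff_snd.fst).mul (((hb j).comp contDiff_snd.snd).mul
    ((g.smooth (b i) (b j)).comp contDiff_fst))

/-- The derivative of `form (c s) (d s) (d s)` depends only on the first-order jet of `(c, d)`; by
invariance it is computed along the orbits of one-parameter groups. -/
theorem hasDerivAt_form (g : InvariantMetric) {p v Y Y' : Mat7} (hp : p ∈ flag)
    (hv : v ∈ tangent p) (hY : Y ∈ g2) (hY' : Y' ∈ g2) {c d : ℝ → Mat7} (hc₀ : c 0 = p)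
    (hd₀ : d 0 = v) (hc : HasDerivAt c ⁅Y, p⁆ 0) (hd : HasDerivAt d (⁅Y', p⁆ + ⁅Y, v⁆) 0) :
    HasDerivAt (fun s => g.form (c s) (d s) (d s)) (2 * g.form p v ⁅Y', p⁆) 0 := by
  let G : Mat7 × Mat7 → ℝ := fun q => g.form q.1 q.2 q.2
  have hG : ContDiff ℝ ∞ G :=
    (contDiff_form g).comp (contDiff_fst.prodMk (contDiff_snd.prodMk contDiff_snd))
  have hG' := (hG.differentiable (by simp) (p, v)).hasFDerivAt
  have key : ∀ c d : ℝ → Mat7, c 0 = p → d 0 = v → HasDerivAt c ⁅Y, p⁆ 0 →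
      HasDerivAt d (⁅Y', p⁆ + ⁅Y, v⁆) 0 → HasDerivAt (fun s => g.form (c s) (d s) (d s))
        (fderiv ℝ G (p, v) (⁅Y, p⁆, ⁅Y', p⁆ + ⁅Y, v⁆)) 0 := by
    rintro c d rfl rfl hc hd
    exact hG'.comp_hasDerivAt (0 : ℝ) (HasDerivAt.prodMk hc hd)
  refine (key c d hc₀ hd₀ hc hd).congr_deriv ?_
  have hu : ⁅Y', p⁆ ∈ tangent p := mem_tangent_iff.mpr ⟨Y', hY', rfl⟩
  -- The ambient extension of the metric is arbitrary off the orbit, so its derivative is not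
  -- accessible directly. The model curves `conjExp (s • Y) p` and `conjExp (s • Y) (v + s • [Y',
  -- p])` have the same first-order jet, and invariance strips off the conjugation, leaving a
  -- quadratic polynomial in `s`.
  have h₁ : HasDerivAt (fun s : ℝ => conjExp (s • Y) p) ⁅Y, p⁆ 0 := by
    simpa [conjExp_zero] using hasDerivAt_conjExp Y (hasDerivAt_const (0 : ℝ) p)
  have h₂ : HasDerivAt (fun s : ℝ => conjExp (s • Y) (v + s • ⁅Y', p⁆)) (⁅Y', p⁆ + ⁅Y, v⁆) 0 := by
    have h : HasDerivAt (fun s : ℝ => v + s • ⁅Y', p⁆) ⁅Y', p⁆ 0 := by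
      have h := ((hasDerivAt_id (0 : ℝ)).smul_const ⁅Y', p⁆).const_add v
      rw [one_smul] at h
      exact h
    simpa [conjExp_zero] using hasDerivAt_conjExp Y h
  have h₃ := key _ _ (by simp [conjExp_zero]) (by simp [conjExp_zero]) h₁ h₂
  have h₄ : (fun s : ℝ => g.form (conjExp (s • Y) p) (conjExp (s • Y) (v + s • ⁅Y', p⁆))
      (conjExp (s • Y) (v + s • ⁅Y', p⁆))) = fun s : ℝ => g.form p v v +
        s * (2 * g.form p v ⁅Y', p⁆) + s ^ 2 * g.form p ⁅Y', p⁆ ⁅Y', p⁆ := by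
    ext1 s
    have hs : v + s • ⁅Y', p⁆ ∈ tangent p := add_mem hv ((tangent p).smul_mem s hu)
    rw [form_conjExp g (g2.smul_mem s hY) hp hs hs]
    simp only [map_add, map_smul, LinearMap.add_apply, LinearMap.smul_apply, smul_eq_mul,
      g.symm p hp _ hu _ hv]
    ring
  rw [h₄] at h₃
  refine h₃.unique ?_
  have h₅ := (((hasDerivAt_id (0 : ℝ)).mul_const (2 * g.form p v ⁅Y', p⁆)).const_add
    (g.form p v v)).add (((hasDerivAt_id (0 : ℝ)).pow 2).mul_const (g.form p ⁅Y', p⁆ ⁅Y', p⁆))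
  exact h₅.congr_deriv (by simp)

theorem homogeneousCurve_mem_flag (X : g2) (t : ℝ) : homogeneousCurve X t ∈ flag :=
  conjExp_mem_flag (g2.smul_mem t X.2) w_mem_flag

theorem contDiff_homogeneousCurve (X : g2) : ContDiff ℝ ∞ (homogeneousCurve X) :=
  contDiff_conjExp (contDiff_id.smul contDiff_const) contDiff_const

theorem hasDerivAt_homogeneousCurve (X : g2) (t : ℝ) :
    HasDerivAt (homogeneousCurve X) (conjExp (t • (X : Mat7)) ⁅(X : Mat7), (w : Mat7)⁆) t := by
  have h := hasDerivAt_conjExp (X : Mat7) (hasDerivAt_const t (w : Mat7))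
  rw [zero_add] at h
  exact h

theorem lie_mem_tangent {p Y : Mat7} (hY : Y ∈ g2) : ⁅Y, p⁆ ∈ tangent p :=
  mem_tangent_iff.mpr ⟨Y, hY, rfl⟩

/-- The first variation of the energy along `t ↦ exp(tX) · o`, for a variation whose field is
`exp(tX) [Z(t), w] exp(-tX)`. -/
theorem hasDerivAt_energy (g : InvariantMetric) (X : g2) (a b : ℝ) {V : ℝ → ℝ → Mat7}
    (hV : ContDiff ℝ ∞ (Function.uncurry V)) (hV₀ : ∀ t, V 0 t = homogeneousCurve X t)
    {Z Z' : ℝ → Mat7} (hZ : ∀ t, HasDerivAt Z (Z' t) t) (hZmem : ∀ t, Z t ∈ g2)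
    (hVZ : ∀ t, deriv (fun s => V s t) 0 = conjExp (t • (X : Mat7)) ⁅Z t, (w : Mat7)⁆) :
    HasDerivAt (fun s => energy g a b (V s))
      (∫ t in a..b, g.form w ⁅(X : Mat7), (w : Mat7)⁆
        ⁅Z' t + ⁅(X : Mat7), Z t⁆, (w : Mat7)⁆) 0 := by
  have hV1 : ContDiff ℝ 1 (Function.uncurry V) := hV.of_le (by simp)
  have hVt : ContDiff ℝ ∞ (Function.uncurry fun s t => deriv (V s) t) := by
    have e : (Function.uncurry fun s t => deriv (V s) t) =
        fun q => fderiv ℝ (Function.uncurry V) q (0, 1) :=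
      funext fun q => (hasDerivAt_snd_of_contDiff hV1 q.1 q.2).deriv
    rw [e]
    exact contDiff_fderiv_apply_const hV _
  have hF : ContDiff ℝ ∞ (Function.uncurry fun s t => g.form (V s t) (deriv (V s) t)
      (deriv (V s) t)) := (contDiff_form g).comp (hV.prodMk (hVt.prodMk hVt))
  have hE := (hasDerivAt_intervalIntegral_of_contDiff (hF.of_le (by simp)) a b 0).const_mul (1 / 2)
  refine hE.congr_deriv ?_
  rw [← intervalIntegral.integral_const_mul]
  refine intervalIntegral.integral_congr fun t _ => ?_
  set x : Mat7 := (X : Mat7) with hx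
  have hXt : t • x ∈ g2 := g2.smul_mem t X.2
  have hZ'mem : Z' t ∈ g2 := mem_g2_of_hasDerivAt (hZ t) hZmem
  have hU : Z' t + ⁅x, Z t⁆ ∈ g2 := g2.add_mem hZ'mem (g2.lie_mem X.2 (hZmem t))
  have hw : (w : Mat7) ∈ flag := w_mem_flag
  have hp : conjExp (t • x) w ∈ flag := conjExp_mem_flag hXt hw
  have hv : conjExp (t • x) ⁅x, (w : Mat7)⁆ ∈ tangent (conjExp (t • x) w) := by
    rw [conjExp_lie]
    exact lie_mem_tangent (conjExp_mem_g2 hXt X.2)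
  have h := hasDerivAt_form g (Y := conjExp (t • x) (Z t))
    (Y' := conjExp (t • x) (Z' t + ⁅x, Z t⁆)) hp hv
    (conjExp_mem_g2 hXt (hZmem t)) (conjExp_mem_g2 hXt hU)
    (c := fun s => V s t) (d := fun s => deriv (V s) t) (hV₀ t) ?_ ?_ ?_
  · change 1 / 2 * deriv _ 0 = _
    rw [h.deriv, ← conjExp_lie, form_conjExp g hXt hw (lie_mem_tangent X.2) (lie_mem_tangent hU)]
    ring
  · rw [show V 0 = homogeneousCurve X from funext hV₀]
    exact (hasDerivAt_homogeneousCurve X t).deriv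
  · rw [← conjExp_lie, ← hVZ]
    exact ((hasDerivAt_fst_of_contDiff hV1 0 t).differentiableAt).hasDerivAt
  · refine (hasDerivAt_deriv_comm hV 0 t).congr_deriv ?_
    have hW : HasDerivAt (fun t => conjExp (t • x) ⁅Z t, (w : Mat7)⁆)
        (conjExp (t • x) (⁅Z' t, (w : Mat7)⁆ + ⁅x, ⁅Z t, (w : Mat7)⁆⁆)) t := by
      refine hasDerivAt_conjExp x ?_
      simp only [Ring.lie_def]
      exact ((hZ t).mul_const _).sub ((hZ t).const_mul _)
    have e : (fun t => deriv (fun s => V s t) 0) =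
        fun t => conjExp (t • x) ⁅Z t, (w : Mat7)⁆ := funext hVZ
    refine (congrArg (deriv · t) e).trans (hW.deriv.trans ?_)
    -- By the Jacobi identity, `[x, [Z, w]] = [[x, Z], w] + [Z, [x, w]]`: the first term joins `[Z',
    -- w]` to form `[Y', p]`, the second is `[Y, v]`, both before conjugation.
    rw [← conjExp_lie, ← conjExp_lie, ← conjExp_add, leibniz_lie x (Z t), add_lie, add_assoc]

/-! ### Invariant forms on `𝔪` -/

theorem bracketCoords_add_right (p q q' : Fin 14 → ℝ) :
    bracketCoords p (q + q') = bracketCoords p q + bracketCoords p q' := by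
  apply coordEquiv.injective
  rw [map_add, ← lie_coordEquiv, ← lie_coordEquiv, ← lie_coordEquiv, map_add, lie_add]

/-- The coordinates of `diagElt ![5, -1, -4]`, on which the positive roots other than `α₂` take
distinct positive values. -/
def genericTorusCoords : Fin 14 → ℝ := ![5, -1, 0, 0, 0, 0, 0, 0, 0, 0, 0, 0, 0, 0]

/-- The weights of the adjoint action of `genericTorusCoords`. -/
def weight : Fin 14 → ℤ := ![0, 0, -1, 1, 6, -6, 5, -5, 4, -4, 3, -3, 9, -9]

/-- The involution that exchanges the two coordinates of each real root space. -/
def partner : Fin 14 → Fin 14 := ![1, 0, 3, 2, 5, 4, 7, 6, 9, 8, 11, 10, 13, 12]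

theorem partner_partner : ∀ i, partner (partner i) = i := by decide

theorem weight_partner : ∀ i, weight (partner i) = -weight i := by decide

theorem genericTorusCoords_eq_zero (i : Fin 14) (hi : 4 ≤ i) : genericTorusCoords i = 0 := by
  fin_cases i <;> first | (exfalso; revert hi; decide) | rfl

theorem bracketCoords_genericTorusCoords (p : Fin 14 → ℝ) (j : Fin 14) :
    bracketCoords genericTorusCoords p j = -(weight j * p (partner j)) := by
  fin_cases j <;> simp [bracketCoords, genericTorusCoords, weight, partner] <;> ring

theorem bracketCoords_genericTorusCoords_single (i : Fin 14) :
    bracketCoords genericTorusCoords (Pi.single i 1) =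
      (weight i : ℝ) • Pi.single (partner i) (1 : ℝ) := by
  ext j
  rw [bracketCoords_genericTorusCoords, Pi.smul_apply, Pi.single_apply, Pi.single_apply]
  by_cases h : j = partner i
  · subst h
    rw [partner_partner, weight_partner]
    simp
  · have h' : partner j ≠ i := fun h' => h (by rw [← h', partner_partner])
    simp [h, h']

theorem polarization_of_bracketCoords {h : LinearMap.BilinForm ℝ (Fin 14 → ℝ)} {k : Fin 14 → ℝ}
    (inv : ∀ p, h p (bracketCoords k p) = 0) (p q : Fin 14 → ℝ) :
    h p (bracketCoords k q) + h q (bracketCoords k p) = 0 := by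
  have h₁ := inv (p + q)
  rw [bracketCoords_add_right, map_add, map_add, LinearMap.add_apply, LinearMap.add_apply,
    inv p, inv q] at h₁
  linarith

/-- A symmetric bilinear form on `g2`, in coordinates, that descends to `g2 / 𝔨` and is invariant
under the isotropy algebra `𝔨`. -/
structure IsIsotropyInvariant (h : LinearMap.BilinForm ℝ (Fin 14 → ℝ)) : Prop where
  symm : ∀ p q, h p q = h q p
  vanish : ∀ k : Fin 14 → ℝ, (∀ i : Fin 14, 4 ≤ i → k i = 0) → ∀ q, h k q = 0
  inv : ∀ k : Fin 14 → ℝ, (∀ i : Fin 14, 4 ≤ i → k i = 0) → ∀ p, h p (bracketCoords k p) = 0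

namespace IsIsotropyInvariant

variable {h : LinearMap.BilinForm ℝ (Fin 14 → ℝ)}

theorem weight_mul_single (H : IsIsotropyInvariant h) (i j : Fin 14) :
    (weight j : ℝ) * h (Pi.single i 1) (Pi.single j 1) =
      weight i * h (Pi.single (partner i) 1) (Pi.single (partner j) 1) := by
  have h₁ := polarization_of_bracketCoords (H.inv _ genericTorusCoords_eq_zero)
    (Pi.single i 1) (Pi.single (partner j) 1)
  rw [bracketCoords_genericTorusCoords_single, bracketCoords_genericTorusCoords_single,
    partner_partner, weight_partner, H.symm (Pi.single (partner j) 1)] at h₁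
  simp at h₁
  linarith

/-- The torus rotates each real root plane, so an invariant form gives both basis vectors the same
length. -/
theorem single_partner (H : IsIsotropyInvariant h) {i : Fin 14} (hi : weight i ≠ 0) :
    h (Pi.single (partner i) 1) (Pi.single (partner i) 1) = h (Pi.single i 1) (Pi.single i 1) :=
  (mul_left_cancel₀ (by exact_mod_cast hi) (H.weight_mul_single i i)).symm

/-- Applying the torus twice multiplies by minus the squared weight, so vectors with different
squared weights are orthogonal. Inside one root plane, skewness of the rotation together with
symmetry of `h` gives the same. -/
theorem single_of_ne (H : IsIsotropyInvariant h) {i j : Fin 14} (hij : i ≠ j) :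
    h (Pi.single i 1) (Pi.single j 1) = 0 := by
  by_cases hi : i < 4
  · exact H.vanish _ (fun l hl => Pi.single_eq_of_ne (hi.trans_le hl).ne' 1) _
  have hsep : ∀ i j : Fin 14, ¬i < 4 → i ≠ j →
      weight i ≠ 0 ∧ (weight i ^ 2 ≠ weight j ^ 2 ∨ j = partner i) := by decide
  obtain ⟨hw, h₁ | rfl⟩ := hsep i j hi hij
  · have h₂ := H.weight_mul_single i j
    have h₃ := H.weight_mul_single (partner i) (partner j)
    rw [partner_partner, partner_partner, weight_partner, weight_partner] at h₃
    push_cast at h₃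
    have h₄ : ((weight i : ℝ) ^ 2 - (weight j : ℝ) ^ 2) *
        h (Pi.single i 1) (Pi.single j 1) = 0 := by
      linear_combination (weight i : ℝ) * h₃ - (weight j : ℝ) * h₂
    refine (mul_eq_zero.mp h₄).resolve_left fun h₅ => h₁ ?_
    exact_mod_cast sub_eq_zero.mp h₅
  · have h₂ := H.weight_mul_single i (partner i)
    rw [partner_partner, weight_partner, H.symm (Pi.single (partner i) 1)] at h₂
    push_cast at h₂
    have h₃ : (weight i : ℝ) * h (Pi.single i 1) (Pi.single (partner i) 1) = 0 := by linarith
    exact (mul_eq_zero.mp h₃).resolve_left (by exact_mod_cast hw)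

theorem single_apply (H : IsIsotropyInvariant h) (i : Fin 14) (q : Fin 14 → ℝ) :
    h (Pi.single i 1) q = q i * h (Pi.single i 1) (Pi.single i 1) := by
  conv_lhs => rw [pi_eq_sum_univ' q]
  rw [map_sum, Finset.sum_eq_single i]
  · simp
  · intro j _ hj
    simp [H.single_of_ne hj.symm]
  · simp

theorem apply_eq_sum (H : IsIsotropyInvariant h) (p q : Fin 14 → ℝ) :
    h p q = ∑ i, p i * (q i * h (Pi.single i 1) (Pi.single i 1)) := by
  conv_lhs => rw [pi_eq_sum_univ' p]
  simp [H.single_apply _ q]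

/-- An isotropy-invariant form satisfies `h(p, [p, q]) = 0` for all `q` as soon as `p` lies in
`𝔪_{α₁}` or in `𝔪_{2α₁}`. -/
theorem apply_bracketCoords_eq_zero (H : IsIsotropyInvariant h) {p : Fin 14 → ℝ}
    (hp : ((∀ i : Fin 14, i < 4 → p i = 0) ∧ p 12 = 0 ∧ p 13 = 0) ∨
      ∀ i : Fin 14, i < 12 → p i = 0) (q : Fin 14 → ℝ) :
    h p (bracketCoords p q) = 0 := by
  have h₅ := H.single_partner (i := 4) (by decide)
  have h₇ := H.single_partner (i := 6) (by decide)
  have h₉ := H.single_partner (i := 8) (by decide)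
  have h₁₁ := H.single_partner (i := 10) (by decide)
  have h₁₃ := H.single_partner (i := 12) (by decide)
  have hz : ∀ i : Fin 14, i < 4 → h (Pi.single i 1) (Pi.single i 1) = 0 := fun i hi =>
    H.vanish _ (fun l hl => Pi.single_eq_of_ne (hi.trans_le hl).ne' 1) _
  -- The basis vector `2` lies in `𝔲_{α₂}`, so it moves along the `α₂`-string `α₁, α₁ + α₂, α₁ +
  -- 2α₂, α₁ + 3α₂` and relates the scales of consecutive planes.
  have root := fun i j => polarization_of_bracketCoords (H.inv (Pi.single 2 1) fun l hl =>
    Pi.single_eq_of_ne (by rintro rfl; revert hl; decide) 1) (Pi.single i 1) (Pi.single j 1)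
  have h₆ := root 4 6
  have h₈ := root 6 8
  have h₁₀ := root 8 10
  rw [H.single_apply 4, H.single_apply 6] at h₆
  rw [H.single_apply 6, H.single_apply 8] at h₈
  rw [H.single_apply 8, H.single_apply 10] at h₁₀
  rw [H.apply_eq_sum]
  generalize hd : (fun i : Fin 14 => h (Pi.single i 1) (Pi.single i 1)) = d
  have hd' : ∀ i, h (Pi.single i 1) (Pi.single i 1) = d i := fun i => congrFun hd i
  simp only [hd'] at *
  simp [bracketCoords] at h₆ h₈ h₁₀
  simp [partner] at h₅ h₇ h₉ h₁₁ h₁₃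
  -- The ratios `1 : 3 : 3 : 1` are those of the squared `negTrace` norms `4, 12, 12, 4` of the
  -- basis vectors, so `h` is a multiple of `negTrace` on `𝔪_{α₁}`. The final `ring` calls then
  -- amount to the invariance of `negTrace`.
  have e₆ : d 6 = 3 * d 4 := by linarith
  have e₈ : d 8 = 3 * d 4 := by linarith
  have e₁₀ : d 10 = d 4 := by linarith
  simp only [Fin.sum_univ_succ]
  rcases hp with ⟨hp, h₁, h₂⟩ | hp
  · simp [bracketCoords, hp, h₁, h₂, h₅, h₇, h₉, h₁₁, hz, e₆, e₈, e₁₀]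
    ring
  · simp [bracketCoords, hp, h₁₃]
    ring

end IsIsotropyInvariant

/-! ### Geodesics -/

/-- The pullback to `g2`, in coordinates, of an invariant metric at the origin. -/
def originForm (g : InvariantMetric) : LinearMap.BilinForm ℝ (Fin 14 → ℝ) :=
  let L : (Fin 14 → ℝ) →ₗ[ℝ] Mat7 :=
    -(LieAlgebra.ad ℝ Mat7 (w : Mat7) ∘ₗ g2.toSubmodule.subtype ∘ₗ coordEquiv.toLinearMap)
  (g.form w).compl₁₂ L L

theorem originForm_apply (g : InvariantMetric) (p q : Fin 14 → ℝ) :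
    originForm g p q = g.form w ⁅ofCoords p, (w : Mat7)⁆ ⁅ofCoords q, (w : Mat7)⁆ := by
  rw [← lie_skew (ofCoords p), ← lie_skew (ofCoords q)]
  rfl

theorem lie_ofCoords_w {k : Fin 14 → ℝ} (hk : ∀ i : Fin 14, 4 ≤ i → k i = 0) :
    ⁅ofCoords k, (w : Mat7)⁆ = 0 := by
  have h : ⁅w, coordEquiv k⁆ = 0 := (mem_isotropyAlgebra_iff k).mpr hk
  rw [← lie_skew, neg_eq_zero]
  exact congrArg Subtype.val h

/-- The isotropy algebra acts by skew endomorphisms on the tangent space at the origin. -/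
theorem form_lie_eq_zero (g : InvariantMetric) {k v : Mat7} (hk : k ∈ g2)
    (hkw : ⁅k, (w : Mat7)⁆ = 0) (hv : v ∈ tangent w) : g.form w v ⁅k, v⁆ = 0 := by
  have hkv : ⁅k, v⁆ ∈ tangent w := by
    obtain ⟨Y, hY, rfl⟩ := mem_tangent_iff.mp hv
    rw [leibniz_lie, hkw, lie_zero, add_zero]
    exact lie_mem_tangent (g2.lie_mem hk hY)
  -- With `Y = k` and `Y' = 0` the base point stays at `w`, since `[k, w] = 0`, and the derivative
  -- is `0`; the direct expansion below gives `2 g(v, [k, v])`.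
  have h₁ := hasDerivAt_form g w_mem_flag hv hk g2.zero_mem (c := fun _ => w)
    (d := fun s : ℝ => v + s • ⁅k, v⁆) rfl (by simp) (by rw [hkw]; exact hasDerivAt_const _ _) (by
      have h := ((hasDerivAt_id (0 : ℝ)).smul_const ⁅k, v⁆).const_add v
      rw [zero_lie, zero_add]
      rw [one_smul] at h
      exact h)
  have h₂ : (fun s : ℝ => g.form w (v + s • ⁅k, v⁆) (v + s • ⁅k, v⁆)) = fun s : ℝ =>
      g.form w v v + s * (2 * g.form w v ⁅k, v⁆) + s ^ 2 * g.form w ⁅k, v⁆ ⁅k, v⁆ := by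
    ext1 s
    simp only [map_add, map_smul, LinearMap.add_apply, LinearMap.smul_apply, smul_eq_mul,
      g.symm w w_mem_flag _ hkv _ hv]
    ring
  rw [h₂, zero_lie, map_zero, mul_zero] at h₁
  have h₃ := (((hasDerivAt_id (0 : ℝ)).mul_const (2 * g.form w v ⁅k, v⁆)).const_add
    (g.form w v v)).add (((hasDerivAt_id (0 : ℝ)).pow 2).mul_const (g.form w ⁅k, v⁆ ⁅k, v⁆))
  have h₄ := h₁.unique h₃
  simpa using h₄

theorem isIsotropyInvariant_originForm (g : InvariantMetric) :
    IsIsotropyInvariant (originForm g) where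
  symm p q := by
    rw [originForm_apply, originForm_apply]
    exact g.symm w w_mem_flag _ (lie_mem_tangent (ofCoords_mem p)) _
      (lie_mem_tangent (ofCoords_mem q))
  vanish k hk q := by
    rw [originForm_apply, lie_ofCoords_w hk, map_zero, LinearMap.zero_apply]
  inv k hk p := by
    have h := form_lie_eq_zero g (ofCoords_mem k) (lie_ofCoords_w hk)
      (lie_mem_tangent (ofCoords_mem p))
    rw [leibniz_lie (ofCoords k), lie_ofCoords_w hk, lie_zero, add_zero, lie_ofCoords] at h
    rw [originForm_apply]
    exact h

theorem form_lie_lie_eq_zero (g : InvariantMetric) {X : g2} (hX : X ∈ mα₁ ∨ X ∈ m2α₁)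
    {Z : Mat7} (hZ : Z ∈ g2) :
    g.form w ⁅(X : Mat7), (w : Mat7)⁆ ⁅⁅(X : Mat7), Z⁆, (w : Mat7)⁆ = 0 := by
  obtain ⟨p, rfl⟩ := coordEquiv.surjective X
  obtain ⟨q, rfl⟩ := exists_ofCoords hZ
  rw [mem_mα₁_iff, mem_m2α₁_iff] at hX
  have h := (isIsotropyInvariant_originForm g).apply_bracketCoords_eq_zero hX q
  rwa [originForm_apply, ← lie_ofCoords] at h

/-- The variation field is carried back to `w` by `exp(-tX)` and lifted by `lieInv` to a smooth
curve `Z` in `g2`. The term in `[X, Z]` of the first variation vanishes, so the integrand is the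
derivative of a fixed linear functional of `Z`, and `Z` is zero at both ends. -/
theorem isGeodesic_homogeneousCurve (g : InvariantMetric) {X : g2} (hX : X ∈ mα₁ ∨ X ∈ m2α₁) :
    IsGeodesic g (homogeneousCurve X) := by
  refine ⟨contDiff_homogeneousCurve X, homogeneousCurve_mem_flag X, ?_⟩
  intro a b _ V hV hVmem hV₀ hVa hVb
  set x : Mat7 := (X : Mat7) with hx
  have hV1 : ContDiff ℝ 1 (Function.uncurry V) := hV.of_le (by simp)
  let W : ℝ → Mat7 := fun t => deriv (fun s => V s t) 0
  have hW : ContDiff ℝ ∞ W := by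
    have e : W = fun t => fderiv ℝ (Function.uncurry V) (0, t) (1, 0) :=
      funext fun t => (hasDerivAt_fst_of_contDiff hV1 0 t).deriv
    rw [e]
    exact (contDiff_fderiv_apply_const hV (1, 0)).comp (contDiff_prodMk_right (0 : ℝ))
  have hWt : ∀ t, W t ∈ tangent (conjExp (t • x) w) := by
    intro t
    have h : HasDerivAt (fun s => V s t) (W t) 0 :=
      (hasDerivAt_fst_of_contDiff hV1 0 t).differentiableAt.hasDerivAt
    have h' := mem_tangent_of_hasDerivAt h fun s => hVmem s t
    rw [hV₀] at h'
    exact h'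
  let U : ℝ → Mat7 := fun t => conjExp (-(t • x)) (W t)
  have hUt : ∀ t, U t ∈ tangent (w : Mat7) := by
    intro t
    obtain ⟨Y, hY, h⟩ := mem_tangent_iff.mp (hWt t)
    refine mem_tangent_iff.mpr ⟨conjExp (-(t • x)) Y,
      conjExp_mem_g2 (g2.neg_mem (g2.smul_mem t X.2)) hY, ?_⟩
    change _ = conjExp (-(t • x)) (W t)
    rw [← h, conjExp_lie, conjExp_neg_conjExp]
  let Z : ℝ → Mat7 := fun t => lieInv w (U t)
  have hU : ContDiff ℝ ∞ U := contDiff_conjExp (contDiff_id.smul contDiff_const).neg hW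
  have hlie : ∀ {f : ℝ → Mat7}, ContDiff ℝ ∞ f → ContDiff ℝ ∞ fun t => ⁅(w : Mat7), f t⁆ := by
    intro f hf
    simp only [Ring.lie_def]
    exact (contDiff_const.mul hf).sub (hf.mul contDiff_const)
  have hZ : ContDiff ℝ ∞ Z :=
    ((hlie (hlie (hlie hU))).add ((hlie hU).const_smul (5 : ℝ))).const_smul (1 / 4 : ℝ)
  have hZd : ∀ t, HasDerivAt Z (deriv Z t) t := fun t =>
    (hZ.differentiable (by simp) t).hasDerivAt
  have hZmem : ∀ t, Z t ∈ g2 := fun t => lieInv_mem w.2 (tangent_le_g2 w_mem_flag (hUt t))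
  have hVZ : ∀ t, deriv (fun s => V s t) 0 = conjExp (t • x) ⁅Z t, (w : Mat7)⁆ := by
    intro t
    rw [lie_lieInv_of_mem_tangent w_mem_flag (hUt t), conjExp_conjExp_neg]
  have hZ₀ : ∀ t, (∀ s, V s t = homogeneousCurve X t) → Z t = 0 := by
    intro t ht
    have h : W t = 0 := by
      change deriv (fun s => V s t) 0 = 0
      rw [funext ht]
      exact deriv_const _ _
    simp [Z, U, h, conjExp, lieInv]
  refine (hasDerivAt_energy g X a b hV hV₀ hZd hZmem hVZ).congr_deriv ?_
  let ℓ : Mat7 →ₗ[ℝ] ℝ :=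
    g.form w ⁅x, (w : Mat7)⁆ ∘ₗ (-(LieAlgebra.ad ℝ Mat7 (w : Mat7)))
  have hℓ : ∀ M, ℓ M = g.form w ⁅x, (w : Mat7)⁆ ⁅M, (w : Mat7)⁆ := by
    intro M
    rw [← lie_skew M]
    rfl
  have hint : ∀ t, g.form w ⁅x, (w : Mat7)⁆ ⁅deriv Z t + ⁅x, Z t⁆, (w : Mat7)⁆ = ℓ (deriv Z t) := by
    intro t
    rw [add_lie, map_add, form_lie_lie_eq_zero g hX (hZmem t), add_zero, hℓ]
  have hcont : Continuous fun t => ℓ (deriv Z t) :=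
    (LinearMap.toContinuousLinearMap ℓ).continuous.comp (hZ.continuous_deriv (by simp))
  have hFTC := intervalIntegral.integral_eq_sub_of_hasDerivAt (f := fun t => ℓ (Z t))
    (f' := fun t => ℓ (deriv Z t)) (a := a) (b := b)
    (fun t _ => (LinearMap.toContinuousLinearMap ℓ).hasFDerivAt.comp_hasDerivAt t (hZd t))
    (hcont.intervalIntegrable a b)
  refine (intervalIntegral.integral_congr fun t _ => hint t).trans (hFTC.trans ?_)
  rw [hZ₀ a hVa, hZ₀ b hVb, sub_self]

/-- The metric induced on the orbit by `-tr (X Y)`. -/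
def inducedMetric : InvariantMetric where
  form _ := negTrace
  smooth _ _ := contDiff_const
  symm _ _ v₁ _ v₂ _ := negTrace_symm v₁ v₂
  pos _ hp _ hv hne := negTrace_pos (tangent_le_g2 hp hv) hne
  invariant A _ p _ v₁ _ v₂ _ := by
    have e : A⁻¹.1 * A.1 = 1 := A.inv_mul
    have h : A.1 * v₁ * A⁻¹.1 * (A.1 * v₂ * A⁻¹.1) = A.1 * (v₁ * v₂ * A⁻¹.1) := by
      calc _ = A.1 * v₁ * (A⁻¹.1 * A.1) * v₂ * A⁻¹.1 := by simp only [mul_assoc]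
        _ = _ := by rw [e]; simp only [mul_assoc, one_mul]
    rw [negTrace_apply, negTrace_apply, h, Matrix.trace_mul_comm, mul_assoc, e, mul_one]

/-- If `t ↦ exp(tX) · o` is a geodesic, then `X` is a geodesic vector. -/
theorem form_lie_lie_eq_zero_of_isGeodesic (g : InvariantMetric) {X : g2}
    (hX : IsGeodesic g (homogeneousCurve X)) {Z : Mat7} (hZ : Z ∈ g2) :
    g.form w ⁅(X : Mat7), (w : Mat7)⁆ ⁅⁅(X : Mat7), Z⁆, (w : Mat7)⁆ = 0 := by
  set x : Mat7 := (X : Mat7) with hx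
  -- This cutoff fixes the end points of `[0, 1]`. In the first variation `A` is multiplied by `∫ f'
  -- = 0` and `B` by `∫ f = 1/6`, so criticality gives `B = 0`.
  let f : ℝ → ℝ := fun t => t * (1 - t)
  have hf : ContDiff ℝ ∞ f := contDiff_id.mul (contDiff_const.sub contDiff_id)
  let Y : ℝ → Mat7 := fun t => conjExp (t • x) (f t • Z)
  have hY : ContDiff ℝ ∞ Y :=
    contDiff_conjExp (contDiff_id.smul contDiff_const) (hf.smul contDiff_const)
  have hYmem : ∀ t, Y t ∈ g2 := fun t =>
    conjExp_mem_g2 (g2.smul_mem t X.2) (g2.smul_mem _ hZ)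
  let V : ℝ → ℝ → Mat7 := fun s t => conjExp (s • Y t) (homogeneousCurve X t)
  have hV : ContDiff ℝ ∞ (Function.uncurry V) :=
    contDiff_conjExp (contDiff_fst.smul (hY.comp contDiff_snd))
      ((contDiff_homogeneousCurve X).comp contDiff_snd)
  have hV₀ : ∀ t, V 0 t = homogeneousCurve X t := fun t => by simp [V, conjExp_zero]
  have hVend : ∀ t, f t = 0 → ∀ s, V s t = homogeneousCurve X t := by
    intro t ht s
    have h : Y t = 0 := by simp [Y, ht, conjExp]
    simp [V, h, conjExp_zero]
  have hVmem : ∀ s t, V s t ∈ flag := fun s t =>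
    conjExp_mem_flag (g2.smul_mem s (hYmem t)) (homogeneousCurve_mem_flag X t)
  have h₁ := hX.2.2 0 1 one_pos V hV hVmem hV₀ (hVend 0 (by simp [f])) (hVend 1 (by simp [f]))
  have hVZ : ∀ t, deriv (fun s => V s t) 0 = conjExp (t • x) ⁅f t • Z, (w : Mat7)⁆ := by
    intro t
    have h := hasDerivAt_conjExp (Y t) (hasDerivAt_const (0 : ℝ) (homogeneousCurve X t))
    refine h.deriv.trans ?_
    rw [zero_smul, conjExp_zero, zero_add, conjExp_lie]
    rfl
  have hfd : ∀ t, HasDerivAt (fun t => f t • Z) ((1 - 2 * t) • Z) t := by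
    intro t
    have h : HasDerivAt f (1 - 2 * t) t := by
      refine ((hasDerivAt_id t).mul ((hasDerivAt_id t).const_sub 1)).congr_deriv ?_
      simp only [id]
      ring
    exact h.smul_const Z
  have h₂ := hasDerivAt_energy g X 0 1 hV hV₀ hfd (fun t => g2.smul_mem _ hZ) hVZ
  set A := g.form w ⁅x, (w : Mat7)⁆ ⁅Z, (w : Mat7)⁆
  set B := g.form w ⁅x, (w : Mat7)⁆ ⁅⁅x, Z⁆, (w : Mat7)⁆
  have h₄ : ∀ t : ℝ, g.form w ⁅x, (w : Mat7)⁆ ⁅(1 - 2 * t) • Z + ⁅x, f t • Z⁆, (w : Mat7)⁆ =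
      (1 - 2 * t) * A + t * (1 - t) * B := by
    intro t
    rw [lie_smul, add_lie, smul_lie, smul_lie, map_add, map_smul, map_smul]
    rfl
  have h₅ : ∀ t : ℝ, HasDerivAt (fun t => (t - t ^ 2) * A + (t ^ 2 / 2 - t ^ 3 / 3) * B)
      ((1 - 2 * t) * A + t * (1 - t) * B) t := by
    intro t
    have d := hasDerivAt_pow (𝕜 := ℝ)
    refine ((((hasDerivAt_id t).sub (d 2 t)).mul_const A).add
      ((((d 2 t).div_const 2).sub ((d 3 t).div_const 3)).mul_const B)).congr_deriv ?_
    simp only [Nat.reduceSub, Nat.cast_ofNat]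
    ring
  have h₆ := intervalIntegral.integral_eq_sub_of_hasDerivAt (a := 0) (b := 1)
    (fun t _ => h₅ t) (Continuous.intervalIntegrable (by fun_prop) _ _)
  have h₇ := (intervalIntegral.integral_congr fun t _ => h₄ t).symm.trans (h₂.unique h₁)
  rw [h₇] at h₆
  norm_num at h₆
  linarith

theorem negTrace_ofCoords (p q : Fin 14 → ℝ) (hp : ∀ i : Fin 14, i < 4 → p i = 0) :
    negTrace (ofCoords p) (ofCoords q) =
      4 * (p 4 * q 4 + p 5 * q 5 + p 10 * q 10 + p 11 * q 11 + p 12 * q 12 + p 13 * q 13) +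
        12 * (p 6 * q 6 + p 7 * q 7 + p 8 * q 8 + p 9 * q 9) := by
  rw [negTrace_apply, Matrix.trace]
  simp only [Matrix.diag, Matrix.mul_apply, Fin.sum_univ_seven]
  simp [ofCoords, hp]
  ring

/-- At `w` this metric pulls back to `negTrace` on `𝔪_{α₁}` and four times it on `𝔪_{2α₁}`. For `X =
X₁ + X₂`, testing with `Z = [X₁, X₂]` gives `-3` times the squared norm of `[X₁, X₂]`. -/
theorem mem_of_isGeodesic_inducedMetric {X : g2} (hm : X ∈ m)
    (hX : IsGeodesic inducedMetric (homogeneousCurve X)) : X ∈ mα₁ ∨ X ∈ m2α₁ := by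
  obtain ⟨p, rfl⟩ := coordEquiv.surjective X
  rw [mem_m_iff] at hm
  rw [mem_mα₁_iff, mem_m2α₁_iff]
  -- test against the bracket of the two components of `X`
  let q : Fin 14 → ℝ := ![0, 0, 0, 0, -p 10 * p 12 - p 11 * p 13, p 11 * p 12 - p 10 * p 13,
    -p 8 * p 12 - p 9 * p 13, p 9 * p 12 - p 8 * p 13, p 6 * p 12 + p 7 * p 13,
    p 6 * p 13 - p 7 * p 12, p 4 * p 12 + p 5 * p 13, p 4 * p 13 - p 5 * p 12, 0, 0]
  have h : negTrace ⁅ofCoords p, (w : Mat7)⁆ ⁅⁅ofCoords p, ofCoords q⁆, (w : Mat7)⁆ = 0 :=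
    form_lie_lie_eq_zero_of_isGeodesic inducedMetric hX (ofCoords_mem q)
  have e : ∀ p, ⁅ofCoords p, (w : Mat7)⁆ = -ofCoords _ := fun p => by
    rw [← lie_skew]
    exact congrArg (- ·) (congrArg Subtype.val (lie_w p))
  rw [lie_ofCoords, e, e, map_neg, map_neg, LinearMap.neg_apply, neg_neg,
    negTrace_ofCoords _ _ (by intro i hi; fin_cases i <;> simp at hi ⊢)] at h
  simp [bracketCoords, q, hm] at h
  -- Bracketing with `X₂` exchanges the planes of `α₁` and `α₁ + 3α₂`, and those of `α₁ + α₂` and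
  -- `α₁ + 2α₂`, scaling squared lengths by `p 12 ^ 2 + p 13 ^ 2`. Hence the squared norm of `[X₁,
  -- X₂]` is a product.
  have h' : (p 12 ^ 2 + p 13 ^ 2) * (p 4 ^ 2 + p 5 ^ 2 + p 10 ^ 2 + p 11 ^ 2 +
      3 * (p 6 ^ 2 + p 7 ^ 2 + p 8 ^ 2 + p 9 ^ 2)) = 0 := by
    linarith
  have sq : ∀ i, 0 ≤ p i ^ 2 := fun i => sq_nonneg (p i)
  have eq_zero : ∀ {i}, p i ^ 2 ≤ 0 → p i = 0 := fun {i} hi =>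
    pow_eq_zero_iff two_ne_zero |>.mp (hi.antisymm (sq i))
  rcases mul_eq_zero.mp h' with h' | h'
  · exact Or.inl ⟨hm, eq_zero (by linarith [sq 13]), eq_zero (by linarith [sq 12])⟩
  · have bound : ∀ i : Fin 14, 4 ≤ i → i < 12 → p i ^ 2 ≤ 0 := by
      intro i h₁ h₂
      fin_cases i <;> first | (exfalso; revert h₁ h₂; decide) |
        (simp only [Fin.reduceFinMk]
         linarith [sq 4, sq 5, sq 6, sq 7, sq 8, sq 9, sq 10, sq 11])
    refine Or.inr fun i hi => ?_
    rcases lt_or_ge i 4 with h₄ | h₄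
    · exact hm i h₄
    · exact eq_zero (bound i h₄ hi)

end

end G2Flag

theorem theoremB :
    (G2Flag.mα₁ ⊔ G2Flag.m2α₁ = G2Flag.m ∧ Disjoint G2Flag.mα₁ G2Flag.m2α₁) ∧
      ∀ X : G2Flag.g2, X ∈ G2Flag.m → X ≠ 0 →
        (G2Flag.IsEquigeodesicVector X ↔ X ∈ G2Flag.mα₁ ∨ X ∈ G2Flag.m2α₁) :=
  ⟨⟨G2Flag.mα₁_sup_m2α₁, G2Flag.disjoint_mα₁_m2α₁⟩, fun _ hm _ =>
    ⟨fun h => G2Flag.mem_of_isGeodesic_inducedMetric hm (h.2 _),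
      fun h => ⟨hm, fun g => G2Flag.isGeodesic_homogeneousCurve g h⟩⟩⟩
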